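/- **Security model.** Let $\mathcal M=\langle S,E,\varphi,s_0\rangle$ be a state machine with $\varphi(e)\subseteq S\times S$, and let $\mathcal D=\mathcal P\cup\{\mathbb S,\mathbb T\}$ be a set of domains (partitions, scheduler, transmitter) with $kdom:S\times E\to\mathcal D$, an interference relation $\leadsto$ on $\mathcal D$ and relations $\sim_d$ on $S$ ($d\in\mathcal D$). Let $run([\,])=Id$, let $run(e\#es)$ be $\varphi(e)$ followed by $run(es)$, and $\mathcal R(s)\iff\exists es.\ (s_0,s)\in run(es)$. This is an instance of the security model if (1) $p_1\leadsto p_2$ implies $p_1\leadsto\mathbb T$ and $\mathbb T\leadsto p_2$ for distinct partitions $p_1,p_2$; (2) $\mathbb S\leadsto d$ for all $d$; (3) $d\leadsto\mathbb S$ only for $d=\mathbb S$; (4) each $\sim_d$ is an equivalence relation; (5) $s\sim_{\mathbb S}t$ implies $kdom(s,e)=kdom(t,e)$; (6) every event has a successor in every reachable state. For an event $e$, *step consistency* $SC(e)$ says: for all $d$ and reachable $s,t$ with $s\sim_d t$, $s\sim_{\mathbb S}t$, $kdom(s,e)\leadsto d$ and $s\sim_{kdom(s,e)}t$, any $e$-successors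 $s',t'$ of $s,t$ satisfy $s'\sim_d t'$; *locally respects* $LR(e)$ says: if $s$ is reachable, $kdom(s,e)\not\leadsto d$ and $(s,s')\in\varphi(e)$, then $s\sim_d s'$. Define $sources([\,],s,d)=\{d\}$ and $$sources(e\#es,s,d)=\bigcup_{(s,s')\in\varphi(e)}sources(es,s',d)\ \cup\ \{kdom(s,e)\mid\exists v,s'.\ kdom(s,e)\leadsto v,\ (s,s')\in\varphi(e),\ v\in sources(es,s',d)\};$$ $ipurge([\,],d,X)=[\,]$, and $ipurge(e\#es,d,X)$ is $e\#ipurge(es,d,\varphi(e)[X])$ if $kdom(s,e)\in sources(e\#es,s,d)$ for some $s\in X$, and $ipurge(es,d,X)$ otherwise. Write $(s,es)\approx_d(t,es')$ if all final states of $es$ from $s$ are $\sim_d$ to all final states of $es'$ from $t$, and $s\sim_A t$ if $s\sim_d t$ for all $d\in A$. For all $d$, all event sequences and all reachable $s,t$: - *noninfluence*: $s\sim_{\mathbb S}t$ and $s\sim_{sources(es,s,d)}t$ imply $(s,es)\approx_d(t,ipurge(es,d,\{t\}))$; - *weak noninfluence*: $s\sim_{\mathbb S}t$, $s\sim_{sources(es_1,s,d)}t$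 and $ipurge(es_1,d,\{s\})=ipurge(es_2,d,\{t\})$ imply $(s,es_1)\approx_d(t,es_2)$; - *nonleakage*: $s\sim_{\mathbb S}t$ and $s\sim_{sources(es,s,d)}t$ imply $(s,es)\approx_d(t,es)$; - *noninterference_r*: $(s,es)\approx_d(s,ipurge(es,d,\{s\}))$; - *weak noninterference_r*: $ipurge(es_1,d,\{s\})=ipurge(es_2,d,\{s\})$ implies $(s,es_1)\approx_d(s,es_2)$; - *(weak) noninterference*: the last two properties for $s=s_0$. **Configuration.** A static configuration consists of partitions with an initial mode and a set of port names, of ports with an identifier, a direction (source or destination) and a kind (sampling, or queuing with a capacity), and of channels: a queuing channel has a source and a destination port, a sampling channel has a source port and a set of destination ports. It is valid if a port belongs to at most one partition, different ports have different identifiers, the endpoints of a channel are configured ports of the right direction and kind, and every port of a partition is an endpoint of a channel. **Top-level ARINC 653 specification.** A state consists of the current domain, the modes of the partitions, the owners of the created ports, and the message buffers of the created ports. Kernel initialization sets the configured modes, creates no port, and selects a current domain. *Schedule* sets the current domain to a partition or the transmitter. This nondeterminism is resolved by an arbitrary fixed selection that may depend on the current domain only. Hypercalls are executed by the current partition: create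 a configured and not yet created sampling or queuing port of that partition; write or read a sampling port; send on, receive from or clear a queuing port; get the identifier or the status of a port; set or get the partition mode (COLD_START to WARM_START is not allowed). Write and send require a source port, read, receive and clear a destination port of the current partition. A message sent to a full queuing port is lost. When the transmitter is current, it may transmit over a configured channel: a sampling message is copied to all created destination ports; on a queuing channel whose source port is created and not empty, the oldest message moves from the source port to the destination port if that port is created and not full. Otherwise one of three rules applies. *Hold*: the state does not change. *Drop*: the message is removed and lost if the destination port is created and full; if it is not created, the state does not change. *Blind*: the message is removed and lost in both cases. Every event that is not enabled or not applicable leaves the state unchanged. The domain of *Schedule* is $\mathbb S$, that of a transmission is $\mathbb T$, that of a hypercall is the current domain. The relation $\leadsto$ is reflexive; $\mathbb S\leadsto d$ for all $d$; $\mathbb T\leadsto p$ iff partition $p$ has a destination port of a channel; $p\leadsto\mathbb T$ iff $p$ has a port that is an endpoint of a channel (under *Blind*: that is the source of a channel); nothing else holds. States are equivalent for $\mathbb S$ if their current domains agree; for $\mathbb T$ if all ports (under *Blind*: all source ports), their owners and their buffers agree; for a partition if its mode, its set of created ports, and the number of messages in each of its destination ports agree. **Theorem.** For every valid configuration, every set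 of messages, every selection and each of the three rules, the top-level specification is an instance of the security model, and a channel from partition $p_1$ to partition $p_2$ implies $p_1\leadsto\mathbb T$ and $\mathbb T\leadsto p_2$. Every event satisfies step consistency and locally respects, and the specification satisfies noninfluence, weak noninfluence, nonleakage, noninterference_r, weak noninterference_r, noninterference and weak noninterference. -/

import Mathlib

universe u v w

/-! ## The security model -/

namespace SecModel

/-- The parameters of the security model: a nondeterministic state machine on the states `S` with
event labels `E`, together with a security configuration on the domains `D`. The scheduler `sched`
and the transmitter `trans` are distinguished domains, all other elements of `D` are partitions. -/
structure System (S : Type u) (E : Type v) (D : Type w) where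
  step : E → SetRel S S
  s0 : S
  kdom : S → E → D
  sched : D
  trans : D
  intf : D → D → Prop
  equiv : D → S → S → Prop

variable {S : Type u} {E : Type v} {D : Type w} (M : System S E D)

/-- `run (e :: es)` first performs `e`, then `es`. -/
def run : List E → SetRel S S
  | [] => SetRel.id
  | e :: es => {x | ∃ s', (x.1, s') ∈ M.step e ∧ (s', x.2) ∈ run es}

/-- The final states of the executions of `es` from `s`. -/
def execution (s : S) (es : List E) : Set S := {s' | (s, s') ∈ run M es}

def Reachable (s : S) : Prop := ∃ es, (M.s0, s) ∈ run M es

/-- Equivalence of two states for all domains in `A`. -/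
def EquivOn (A : Set D) (s t : S) : Prop := ∀ d ∈ A, M.equiv d s t

/-- Equivalence for `d` of any two members of two sets of states. -/
def SetEquiv (d : D) (ss ts : Set S) : Prop := ∀ s ∈ ss, ∀ t ∈ ts, M.equiv d s t

def sources : List E → S → D → Set D
  | [], _, d => {d}
  | e :: es, s, d =>
      (⋃ s' ∈ {s' | (s, s') ∈ M.step e}, sources es s' d) ∪
        {x | x = M.kdom s e ∧
          ∃ y s', M.intf x y ∧ (s, s') ∈ M.step e ∧ y ∈ sources es s' d}

open Classical in
noncomputable def ipurge : List E → D → Set S → List E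
  | [], _, _ => []
  | e :: es, d, ss =>
      if ∃ s ∈ ss, M.kdom s e ∈ sources M (e :: es) s d then
        e :: ipurge es d (⋃ s ∈ ss, {s' | (s, s') ∈ M.step e})
      else ipurge es d ss

/-- Observational equivalence for `d` of the executions of `es₁` from `s` and of `es₂` from `t`. -/
def ExecEquiv (d : D) (s : S) (es₁ : List E) (t : S) (es₂ : List E) : Prop :=
  SetEquiv M d (execution M s es₁) (execution M t es₂)

/-- The assumptions of the security model. -/
structure IsSecurityModel : Prop where
  sched_ne_trans : M.sched ≠ M.trans
  part_intf : ∀ p₁ p₂, p₁ ≠ M.sched → p₁ ≠ M.trans → p₂ ≠ M.sched → p₂ ≠ M.trans → p₁ ≠ p₂ →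
    M.intf p₁ p₂ → M.intf p₁ M.trans ∧ M.intf M.trans p₂
  sched_intf : ∀ d, M.intf M.sched d
  intf_sched : ∀ d, M.intf d M.sched → d = M.sched
  equivalence : ∀ d, Equivalence (M.equiv d)
  kdom_eq : ∀ s t e, M.equiv M.sched s t → M.kdom s e = M.kdom t e
  enabled : ∀ s e, Reachable M s → ∃ s', (s, s') ∈ M.step e

/-- Step consistency of an event. -/
def StepConsistent (e : E) : Prop :=
  ∀ d s t, Reachable M s → Reachable M t → M.equiv d s t → M.equiv M.sched s t →
    M.intf (M.kdom s e) d → M.equiv (M.kdom s e) s t →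
    ∀ s' t', (s, s') ∈ M.step e → (t, t') ∈ M.step e → M.equiv d s' t'

/-- The locally respects condition of an event. -/
def LocallyRespects (e : E) : Prop :=
  ∀ d s s', Reachable M s → ¬ M.intf (M.kdom s e) d → (s, s') ∈ M.step e → M.equiv d s s'

def Noninterference : Prop :=
  ∀ d es, ExecEquiv M d M.s0 es M.s0 (ipurge M es d {M.s0})

def WeakNoninterference : Prop :=
  ∀ d es₁ es₂, ipurge M es₁ d {M.s0} = ipurge M es₂ d {M.s0} → ExecEquiv M d M.s0 es₁ M.s0 es₂

def NoninterferenceR : Prop :=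
  ∀ d es s, Reachable M s → ExecEquiv M d s es s (ipurge M es d {s})

def WeakNoninterferenceR : Prop :=
  ∀ d es₁ es₂ s, Reachable M s → ipurge M es₁ d {s} = ipurge M es₂ d {s} →
    ExecEquiv M d s es₁ s es₂

def Nonleakage : Prop :=
  ∀ d es s t, Reachable M s → Reachable M t → M.equiv M.sched s t →
    EquivOn M (sources M es s d) s t → ExecEquiv M d s es t es

def WeakNoninfluence : Prop :=
  ∀ d es₁ es₂ s t, Reachable M s → Reachable M t → EquivOn M (sources M es₁ s d) s t →
    M.equiv M.sched s t → ipurge M es₁ d {s} = ipurge M es₂ d {t} → ExecEquiv M d s es₁ t es₂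

def Noninfluence : Prop :=
  ∀ d es s t, Reachable M s → Reachable M t → EquivOn M (sources M es s d) s t →
    M.equiv M.sched s t → ExecEquiv M d s es t (ipurge M es d {t})

end SecModel

/-! ## The top-level functional specification -/

namespace Arinc

abbrev PartId := ℕ
abbrev PortId := ℕ
abbrev ChannelId := ℕ
abbrev PortName := String

inductive PartMode
  | idle | warmStart | coldStart | normal

inductive PortDir
  | source | destination

inductive PortKind
  | sampling
  | queuing (capacity : ℕ)

/-- A configured port. Its identifier is part of the configuration. -/
structure PortConf where
  id : PortId
  dir : PortDir
  kind : PortKind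

/-- A configured partition: its mode after kernel initialization and the names of its ports. -/
structure PartitionConf where
  initMode : PartMode
  ports : Set PortName

inductive Channel
  | queuing (id : ChannelId) (src dst : PortName)
  | sampling (id : ChannelId) (src : PortName) (dsts : Set PortName)

def Channel.IsSrc : Channel → PortName → Prop
  | .queuing _ sn _, n => n = sn
  | .sampling _ sn _, n => n = sn

def Channel.IsDst : Channel → PortName → Prop
  | .queuing _ _ dn, n => n = dn
  | .sampling _ _ dns, n => n ∈ dns

/-- The static system configuration. -/
structure SysConfig where
  partconf : PartId → Option PartitionConf
  portconf : PortName → Option PortConf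
  channels : Set Channel

namespace SysConfig

/-- The names of the ports of a partition. -/
def portsOf (sc : SysConfig) (a : PartId) : Set PortName :=
  {n | ∃ pc, sc.partconf a = some pc ∧ n ∈ pc.ports}

def IsSamplingConf (sc : SysConfig) (n : PortName) (dir : PortDir) : Prop :=
  ∃ c, sc.portconf n = some c ∧ c.dir = dir ∧ c.kind = .sampling

def IsQueuingConf (sc : SysConfig) (n : PortName) (dir : PortDir) : Prop :=
  ∃ c k, sc.portconf n = some c ∧ c.dir = dir ∧ c.kind = .queuing k

/-- The configuration constraints. -/
structure Valid (sc : SysConfig) : Prop where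
  /-- A port belongs to at most one partition. -/
  port_owner : ∀ n a b, n ∈ sc.portsOf a → n ∈ sc.portsOf b → a = b
  /-- Different ports have different identifiers. -/
  port_id : ∀ n m c c', sc.portconf n = some c → sc.portconf m = some c' → c.id = c'.id → n = m
  /-- Channels lead from source ports to destination ports of their mode. -/
  queuing_channel : ∀ i sn dn, Channel.queuing i sn dn ∈ sc.channels →
    sc.IsQueuingConf sn .source ∧ sc.IsQueuingConf dn .destination
  sampling_channel : ∀ i sn dns, Channel.sampling i sn dns ∈ sc.channels →
    sc.IsSamplingConf sn .source ∧ ∀ dn ∈ dns, sc.IsSamplingConf dn .destination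
  /-- Ports of partitions are endpoints of channels. -/
  port_endpoint : ∀ a, ∀ n ∈ sc.portsOf a, ∃ ch ∈ sc.channels, ch.IsSrc n ∨ ch.IsDst n

/-- There is a channel from the partition `a` to the partition `b`. -/
def ChannelFromTo (sc : SysConfig) (a b : PartId) : Prop :=
  ∃ ch ∈ sc.channels, (∃ n ∈ sc.portsOf a, ch.IsSrc n) ∧ ∃ n ∈ sc.portsOf b, ch.IsDst n

/-- The configured partitions. -/
abbrev Part (sc : SysConfig) := {a : PartId // sc.partconf a ≠ none}

end SysConfig

/-- The security domains: the configured partitions, the scheduler and the transmitter. -/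
inductive Dom (sc : SysConfig)
  | part (a : sc.Part)
  | sched
  | trans

def Dom.IsPart {sc : SysConfig} : Dom sc → Prop
  | .part _ => True
  | _ => False

/-- A created port with its message buffer. -/
inductive Port (Msg : Type u)
  | queuing (name : PortName) (dir : PortDir) (buf : List Msg)
  | sampling (name : PortName) (dir : PortDir) (msg : Option Msg)

namespace Port

variable {Msg : Type u}

def name : Port Msg → PortName
  | .queuing n _ _ => n
  | .sampling n _ _ => n

def dir : Port Msg → PortDir
  | .queuing _ d _ => d
  | .sampling _ d _ => d

def IsQueuing : Port Msg → Prop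
  | .queuing _ _ _ => True
  | .sampling _ _ _ => False

/-- The messages in the buffer, the oldest one first. -/
def msgs : Port Msg → List Msg
  | .queuing _ _ b => b
  | .sampling _ _ m => m.toList

end Port

/-- The kernel state. -/
@[ext] structure KState (sc : SysConfig) (Msg : Type u) where
  cur : Dom sc
  partitions : PartId → Option PartMode
  partPorts : PortId → Option PartId
  comm : PortId → Option (Port Msg)

/-- How the scheduler resolves its choice of the current domain: initially, and then at each
scheduling event. The chosen domain is a configured partition or the transmitter, and the choice
may depend on the state of the scheduler only, which is the current domain. -/
structure Selection (sc : SysConfig) where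
  initial : Dom sc
  next : Dom sc → Dom sc
  initial_ne : initial ≠ .sched
  next_ne : ∀ d, next d ≠ .sched

/-- What the transmitter does with a message of a queuing channel that cannot be delivered.
`hold`: if the destination port is full or not created, the state does not change;
`drop`: if the destination port is full, the message is lost; if it is not created, the state does
not change;
`blind`: if the destination port is full or not created, the message is lost, so that the source
port changes independently of the destination port. -/
inductive LossRule
  | hold | drop | blind

variable {Msg : Type u} {sc : SysConfig}

namespace KState

/-- The current executing partition. -/
def curPart (s : KState sc Msg) : Option PartId :=
  match s.cur with
  | .part a => some a.1
  | _ => none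

def IsPortOfCur (s : KState sc Msg) (p : PortId) : Prop :=
  ∃ a, s.curPart = some a ∧ s.partPorts p = some a

def IsQueuingPort (s : KState sc Msg) (p : PortId) : Prop :=
  ∃ q, s.comm p = some q ∧ q.IsQueuing

def IsSamplingPort (s : KState sc Msg) (p : PortId) : Prop :=
  ∃ q, s.comm p = some q ∧ ¬ q.IsQueuing

def IsSourcePort (s : KState sc Msg) (p : PortId) : Prop :=
  ∃ q, s.comm p = some q ∧ q.dir = .source

def IsDestPort (s : KState sc Msg) (p : PortId) : Prop :=
  ∃ q, s.comm p = some q ∧ q.dir = .destination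

/-- The messages in the buffer of a port. -/
def portMsgs (s : KState sc Msg) (p : PortId) : List Msg :=
  match s.comm p with
  | some q => q.msgs
  | none => []

/-- The number of messages of a created destination port, `none` for all other identifiers. -/
def destMsgs (s : KState sc Msg) (p : PortId) : Option ℕ :=
  match s.comm p with
  | some q =>
    match q.dir with
    | .destination => some q.msgs.length
    | .source => none
  | none => none

open Classical in
/-- The identifier of the created port with a given name. -/
noncomputable def portIdByName (s : KState sc Msg) (n : PortName) : Option PortId :=
  if h : ∃ p q, s.comm p = some q ∧ q.name = n then some h.choose else none

/-- The buffer of a queuing port is full. -/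
def IsFullQueuing (sc' : SysConfig) (s : KState sc Msg) (p : PortId) : Prop :=
  ∃ n d b c k, s.comm p = some (.queuing n d b) ∧ sc'.portconf n = some c ∧
    c.kind = .queuing k ∧ k ≤ b.length

/-- Replace the state of the port `p`. -/
def setPort (s : KState sc Msg) (p : PortId) (q : Port Msg) : KState sc Msg :=
  { s with comm := Function.update s.comm p (some q) }

/-- Insert a message at the end of the buffer of a queuing port. -/
def insertMsg (s : KState sc Msg) (p : PortId) (m : Msg) : KState sc Msg :=
  match s.comm p with
  | some (.queuing n d b) => s.setPort p (.queuing n d (b ++ [m]))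
  | _ => s

/-- Remove the oldest message from the buffer of a queuing port. -/
def removeMsg (s : KState sc Msg) (p : PortId) : KState sc Msg × Option Msg :=
  match s.comm p with
  | some (.queuing n d (m :: b)) => (s.setPort p (.queuing n d b), some m)
  | _ => (s, none)

end KState

section Services

open Classical

/-- Kernel initialization. No port is created yet. -/
def systemInit (sc : SysConfig) (Msg : Type u) (sel : Selection sc) : KState sc Msg where
  cur := sel.initial
  partitions := fun a => (sc.partconf a).map PartitionConf.initMode
  partPorts := fun _ => none
  comm := fun _ => none

def schedule (sel : Selection sc) (s : KState sc Msg) : KState sc Msg :=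
  { s with cur := sel.next s.cur }

noncomputable def setPartMode (s : KState sc Msg) (m : PartMode) : KState sc Msg :=
  match s.curPart with
  | none => s
  | some a =>
    match s.partitions a with
    | none => s
    | some m₀ =>
      if m₀ = .coldStart ∧ m = .warmStart then s
      else { s with partitions := Function.update s.partitions a (some m) }

def getPartStatus (s : KState sc Msg) : KState sc Msg × Option PartMode :=
  (s, s.curPart.bind s.partitions)

/-- Create the port named `n` with the given initial buffer in the current partition, provided that
it is configured with the right mode in that partition and has not been created. -/
noncomputable def createPort (s : KState sc Msg) (n : PortName)
    (ok : PortKind → Prop) (new : PortDir → Port Msg) : KState sc Msg × Option PortId :=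
  match s.curPart, sc.portconf n with
  | some a, some c =>
    if ok c.kind ∧ n ∈ sc.portsOf a ∧ s.portIdByName n = none then
      ({ s with
          partPorts := Function.update s.partPorts c.id (some a)
          comm := Function.update s.comm c.id (some (new c.dir)) }, some c.id)
    else (s, none)
  | _, _ => (s, none)

noncomputable def createSamplingPort (s : KState sc Msg) (n : PortName) :
    KState sc Msg × Option PortId :=
  createPort s n (fun k => k = .sampling) (fun d => .sampling n d none)

noncomputable def createQueuingPort (s : KState sc Msg) (n : PortName) :
    KState sc Msg × Option PortId :=
  createPort s n (fun k => ∃ c, k = .queuing c) (fun d => .queuing n d [])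

/-- Write a message, which replaces the previous one, to a sampling source port. -/
noncomputable def writeSamplingMsg (s : KState sc Msg) (p : PortId) (m : Msg) :
    KState sc Msg × Bool :=
  if ¬ s.IsSamplingPort p ∨ ¬ s.IsSourcePort p ∨ ¬ s.IsPortOfCur p then (s, false)
  else
    match s.comm p with
    | some q => (s.setPort p (.sampling q.name q.dir (some m)), true)
    | none => (s, false)

/-- Read the message of a sampling destination port. The message stays in the port. -/
noncomputable def readSamplingMsg (s : KState sc Msg) (p : PortId) :
    KState sc Msg × Option Msg :=
  if ¬ s.IsSamplingPort p ∨ ¬ s.IsDestPort p ∨ ¬ s.IsPortOfCur p then (s, none)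
  else (s, (s.portMsgs p).head?)

/-- Send a message on a queuing source port. The message is lost if the port is full. -/
noncomputable def sendQueuingMsgLost (s : KState sc Msg) (p : PortId) (m : Msg) :
    KState sc Msg × Bool :=
  if ¬ s.IsQueuingPort p ∨ ¬ s.IsSourcePort p ∨ ¬ s.IsPortOfCur p then (s, false)
  else if s.IsFullQueuing sc p then (s, true)
  else (s.insertMsg p m, true)

/-- Receive a message on a queuing destination port. -/
noncomputable def receiveQueuingMsg (s : KState sc Msg) (p : PortId) :
    KState sc Msg × Option Msg :=
  if ¬ s.IsQueuingPort p ∨ ¬ s.IsDestPort p ∨ ¬ s.IsPortOfCur p then (s, none)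
  else s.removeMsg p

/-- Discard all messages of a queuing destination port. -/
noncomputable def clearQueuingPort (s : KState sc Msg) (p : PortId) : KState sc Msg × Bool :=
  if ¬ s.IsQueuingPort p ∨ ¬ s.IsDestPort p ∨ ¬ s.IsPortOfCur p then (s, false)
  else
    match s.comm p with
    | some q => (s.setPort p (.queuing q.name q.dir []), true)
    | none => (s, false)

/-- The identifier of a created port of the current partition. -/
noncomputable def getPortId (s : KState sc Msg) (n : PortName) : KState sc Msg × Option PortId :=
  match s.curPart with
  | some a => if n ∈ sc.portsOf a then (s, s.portIdByName n) else (s, none)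
  | none => (s, none)

/-- The direction and, for a destination port, the number of messages of a port of the current
partition. -/
noncomputable def getPortStatus (s : KState sc Msg) (p : PortId) :
    KState sc Msg × Option (PortDir × Option ℕ) :=
  if s.IsPortOfCur p then (s, (s.comm p).map fun q => (q.dir, s.destMsgs p)) else (s, none)

/-- Transmission of one message on a queuing channel. -/
noncomputable def transfQueMsgLost (rule : LossRule) (s : KState sc Msg) :
    Channel → KState sc Msg
  | .queuing _ sn dn =>
    match s.portIdByName sn with
    | none => s
    | some sp =>
      match (s.removeMsg sp).2 with
      | none => s
      | some m =>
        let s₁ := (s.removeMsg sp).1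
        match s.portIdByName dn with
        | none => if rule = .blind then s₁ else s
        | some dp =>
          if s₁.IsFullQueuing sc dp then (if rule = .hold then s else s₁)
          else s₁.insertMsg dp m
  | .sampling _ _ _ => s

/-- Transmission on a sampling channel: the message of the source port is copied to all created
destination ports. -/
noncomputable def transfSamplingMsg (s : KState sc Msg) : Channel → KState sc Msg
  | .sampling _ sn dns =>
    match s.portIdByName sn with
    | none => s
    | some sp =>
      match (s.portMsgs sp).head? with
      | none => s
      | some m =>
        { s with comm := fun p => (s.comm p).map fun q =>
            match q with
            | .sampling n d b => .sampling n d (if n ∈ dns then some m else b)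
            | .queuing n d b => .queuing n d b }
  | .queuing _ _ _ => s

end Services

/-- The partition management and inter-partition communication services. -/
inductive Hypercall (Msg : Type u)
  | createSamplingPort (n : PortName)
  | writeSamplingMessage (p : PortId) (m : Msg)
  | readSamplingMessage (p : PortId)
  | getSamplingPortId (n : PortName)
  | getSamplingPortStatus (p : PortId)
  | createQueuingPort (n : PortName)
  | sendQueuingMessage (p : PortId) (m : Msg)
  | receiveQueuingMessage (p : PortId)
  | getQueuingPortId (n : PortName)
  | getQueuingPortStatus (p : PortId)
  | clearQueuingPort (p : PortId)
  | setPartitionMode (m : PartMode)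
  | getPartitionStatus

inductive SysEvent
  | schedule
  | transferSamplingMessage (ch : Channel)
  | transferQueuingMessage (ch : Channel)

inductive Event (Msg : Type u)
  | hyperc (h : Hypercall Msg)
  | sys (e : SysEvent)

noncomputable def execHypercall (s : KState sc Msg) : Hypercall Msg → KState sc Msg
  | .createSamplingPort n => (createSamplingPort s n).1
  | .writeSamplingMessage p m => (writeSamplingMsg s p m).1
  | .readSamplingMessage p => (readSamplingMsg s p).1
  | .getSamplingPortId n => (getPortId s n).1
  | .getSamplingPortStatus p => (getPortStatus s p).1
  | .createQueuingPort n => (createQueuingPort s n).1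
  | .sendQueuingMessage p m => (sendQueuingMsgLost s p m).1
  | .receiveQueuingMessage p => (receiveQueuingMsg s p).1
  | .getQueuingPortId n => (getPortId s n).1
  | .getQueuingPortStatus p => (getPortStatus s p).1
  | .clearQueuingPort p => (clearQueuingPort s p).1
  | .setPartitionMode m => setPartMode s m
  | .getPartitionStatus => (getPartStatus s).1

/-- Hypercalls are executed in partitions, transmissions over configured channels by the
transmitter. Scheduling is always possible. -/
def EventEnabled (s : KState sc Msg) : Event Msg → Prop
  | .hyperc _ => s.cur.IsPart
  | .sys .schedule => True
  | .sys (.transferSamplingMessage ch) => s.cur = .trans ∧ ch ∈ sc.channels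
  | .sys (.transferQueuingMessage ch) => s.cur = .trans ∧ ch ∈ sc.channels

/-- The event specification: the set of possible next states. -/
noncomputable def eventSpec (sel : Selection sc) (rule : LossRule) :
    Event Msg → KState sc Msg → Set (KState sc Msg)
  | .hyperc h, s => {execHypercall s h}
  | .sys .schedule, s => {schedule sel s}
  | .sys (.transferSamplingMessage ch), s => {transfSamplingMsg s ch}
  | .sys (.transferQueuingMessage ch), s => {transfQueMsgLost rule s ch}

open Classical in
/-- The execution of an event, which has no effect when it is not enabled. -/
noncomputable def execEvent (sel : Selection sc) (rule : LossRule) (e : Event Msg) :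
    SetRel (KState sc Msg) (KState sc Msg) :=
  {x | x.2 ∈ if EventEnabled x.1 e then eventSpec sel rule e x.1 else {x.1}}

def eventDom (s : KState sc Msg) : Event Msg → Dom sc
  | .hyperc _ => s.cur
  | .sys .schedule => .sched
  | .sys (.transferSamplingMessage _) => .trans
  | .sys (.transferQueuingMessage _) => .trans

/-- A partition may interfere with the transmitter if one of its ports is an endpoint of a channel.
If the transmitter is blind for destination ports, the port has to be the source of the channel. -/
def PartIntfTrm (sc : SysConfig) (rule : LossRule) (a : PartId) : Prop :=
  ∃ n ∈ sc.portsOf a, ∃ ch ∈ sc.channels, ch.IsSrc n ∨ (rule ≠ .blind ∧ ch.IsDst n)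

/-- The transmitter may interfere with a partition that has the destination port of a channel. -/
def TrmIntfPart (sc : SysConfig) (a : PartId) : Prop :=
  ∃ n ∈ sc.portsOf a, ∃ ch ∈ sc.channels, ch.IsDst n

/-- The interference relation. -/
def Interference (sc : SysConfig) (rule : LossRule) : Dom sc → Dom sc → Prop
  | .sched, _ => True
  | _, .sched => False
  | .trans, .trans => True
  | .part a, .trans => PartIntfTrm sc rule a
  | .trans, .part b => TrmIntfPart sc b
  | .part a, .part b => a = b

/-- Equal communication abilities of a partition: it has the same ports, and its destination ports
have the same numbers of messages. -/
def VpeqPartComm (a : PartId) (s t : KState sc Msg) : Prop :=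
  (∀ p, s.partPorts p = some a ↔ t.partPorts p = some a) ∧
    ∀ p, s.partPorts p = some a → s.destMsgs p = t.destMsgs p

def VpeqPart (a : PartId) (s t : KState sc Msg) : Prop :=
  s.partitions a = t.partitions a ∧ VpeqPartComm a s t

/-- Equivalence for the transmitter: all ports and their states are the same. If the transmitter is
blind for destination ports, this concerns the source ports only. -/
def VpeqTrm (rule : LossRule) (s t : KState sc Msg) : Prop :=
  ∀ p, (rule = .blind → s.IsSourcePort p ∨ t.IsSourcePort p) →
    s.partPorts p = t.partPorts p ∧ s.comm p = t.comm p

/-- State equivalence for a domain. -/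
def Vpeq (rule : LossRule) : Dom sc → KState sc Msg → KState sc Msg → Prop
  | .part a, s, t => VpeqPart a.1 s t
  | .sched, s, t => s.cur = t.cur
  | .trans, s, t => VpeqTrm rule s t

/-- The top-level specification. -/
noncomputable def topLevel (sc : SysConfig) (Msg : Type u) (sel : Selection sc)
    (rule : LossRule) : SecModel.System (KState sc Msg) (Event Msg) (Dom sc) where
  step := execEvent sel rule
  s0 := systemInit sc Msg sel
  kdom := eventDom
  sched := .sched
  trans := .trans
  intf := Interference sc rule
  equiv := Vpeq rule

end Arinc

/-!
The security properties are reduced to step consistency and locally respects by unwinding. Call two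
reachable states related for a sequence of events and a domain `d` if the scheduler and all members
of the sources of the sequence cannot distinguish them (`SecModel.Related`). An event performed on
both sides leads to related states (`Related.step`), and an event whose domain is not a source can
be skipped on one side (`Related.skip_left`). The scheduler interferes with all domains and events
are always enabled, so that the sources are never empty and a skipped event is not a scheduling
event. Related states have the same sources and the same purged sequences, and noninfluence follows
by induction on the sequence (`execEquiv_ipurge`). The other properties are consequences: the purged
execution has a final state, with which two others can be compared (`ExecEquiv.trans_symm`).

For the top-level specification, the argument rests on the invariant `KState.Conforms`: a created
port has the configured identifier, direction and kind, and belongs to its configured partition.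
Hence an identifier determines a port up to its buffer, and a name is found at one identifier at
most. As every port of a partition is an endpoint of a channel, a partition that does not interfere
with the transmitter has no port that the transmitter observes, and a partition with which the
transmitter does not interfere has no destination port.

Apart from port creation and mode changes, every service and every transmission applies to each
created port a function that changes the buffer only (`KState.mapPorts`). A partition observes the
lengths of the buffers of its destination ports, and the transmitter observes ports as a whole. It
therefore suffices that the new length of a destination buffer depends on its old length and on what
the acting domain observes, and that ports observed by the transmitter change in a way determined
by such ports (`vpeqPart_mapPorts`, `vpeqTrm_mapPorts`). For queuing channels under the blind rule,
this holds because the message leaves the source port whatever the state of the destination port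
is (`queueEffect_blind_of_ne`), and because fullness of the destination port is visible to its
owner (`queueEffect_length`).
-/

/-! ### Unwinding -/

namespace SecModel

variable {S : Type u} {E : Type v} {D : Type w} {M : System S E D}

theorem run_append {es es' : List E} {s t r : S} (h : (s, t) ∈ run M es)
    (h' : (t, r) ∈ run M es') : (s, r) ∈ run M (es ++ es') := by
  induction es generalizing s with
  | nil => cases h; exact h'
  | cons e es ih =>
    obtain ⟨s', h₁, h₂⟩ := h
    exact ⟨s', h₁, ih h₂⟩

theorem Reachable.step {s s' : S} {e : E} (hs : Reachable M s) (h : (s, s') ∈ M.step e) :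
    Reachable M s' := by
  obtain ⟨es, hes⟩ := hs
  exact ⟨es ++ [e], run_append hes ⟨s', h, rfl⟩⟩

/-- A property that holds initially and is preserved by every event holds in all reachable
states. -/
theorem Reachable.induction {P : S → Prop} (h0 : P M.s0)
    (hstep : ∀ s s' e, P s → (s, s') ∈ M.step e → P s') {s : S} (hs : Reachable M s) : P s := by
  obtain ⟨es, hes⟩ := hs
  suffices ∀ r, P r → (r, s) ∈ run M es → P s from this _ h0 hes
  clear hes
  induction es with
  | nil => rintro r hr ⟨⟩; exact hr
  | cons e es ih =>
    rintro r hr ⟨r', h₁, h₂⟩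
    exact ih r' (hstep _ _ _ hr h₁) h₂

theorem mem_sources_cons_of_mem {e : E} {es : List E} {s s' : S} {d v : D}
    (h : (s, s') ∈ M.step e) (hv : v ∈ sources M es s' d) : v ∈ sources M (e :: es) s d :=
  Or.inl (Set.mem_biUnion (x := s') h hv)

theorem kdom_mem_sources_cons {e : E} {es : List E} {s s' : S} {d v : D}
    (h : (s, s') ∈ M.step e) (hv : v ∈ sources M es s' d) (hi : M.intf (M.kdom s e) v) :
    M.kdom s e ∈ sources M (e :: es) s d :=
  Or.inr ⟨rfl, v, s', hi, h, hv⟩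

theorem execution_nonempty (hM : IsSecurityModel M) (es : List E) {s : S} (hs : Reachable M s) :
    (execution M s es).Nonempty := by
  induction es generalizing s with
  | nil => exact ⟨s, rfl⟩
  | cons e es ih =>
    obtain ⟨s', hs'⟩ := hM.enabled s e hs
    obtain ⟨r, hr⟩ := ih (hs.step hs')
    exact ⟨r, s', hs', hr⟩

theorem sources_nonempty (hM : IsSecurityModel M) (es : List E) {s : S} (d : D)
    (hs : Reachable M s) : (sources M es s d).Nonempty := by
  induction es generalizing s with
  | nil => exact ⟨d, rfl⟩
  | cons e es ih =>
    obtain ⟨s', hs'⟩ := hM.enabled s e hs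
    obtain ⟨v, hv⟩ := ih (hs.step hs')
    exact ⟨v, mem_sources_cons_of_mem hs' hv⟩

/-- Two reachable states that the scheduler and all domains in the sources of `es` (computed from
the first one) cannot distinguish. This is the relation that unwinding propagates. -/
structure Related (M : System S E D) (es : List E) (d : D) (s t : S) : Prop where
  left : Reachable M s
  right : Reachable M t
  sched : M.equiv M.sched s t
  sources : EquivOn M (sources M es s d) s t

theorem Related.refl (hM : IsSecurityModel M) (es : List E) (d : D) {s : S}
    (hs : Reachable M s) : Related M es d s s :=
  ⟨hs, hs, (hM.equivalence _).refl _, fun v _ => (hM.equivalence v).refl _⟩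

theorem Related.kdom_eq (hM : IsSecurityModel M) {es : List E} {d : D} {s t : S}
    (h : Related M es d s t) (e : E) : M.kdom s e = M.kdom t e :=
  hM.kdom_eq _ _ _ h.sched

/-- A domain whose action is outside the sources is not the scheduler, because the scheduler
interferes with every domain. -/
theorem kdom_ne_sched (hM : IsSecurityModel M) {e : E} {es : List E} {d : D} {s : S}
    (hs : Reachable M s) (hk : M.kdom s e ∉ sources M (e :: es) s d) : M.kdom s e ≠ M.sched := by
  intro he
  obtain ⟨s', hs'⟩ := hM.enabled s e hs
  obtain ⟨v, hv⟩ := sources_nonempty hM es d (hs.step hs')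
  exact hk (kdom_mem_sources_cons hs' hv (he ▸ hM.sched_intf v))

/-- An event whose domain is outside the sources can be skipped on the left. -/
theorem Related.skip_left (hM : IsSecurityModel M) (hlr : ∀ e, LocallyRespects M e)
    {e : E} {es : List E} {d : D} {s t s' : S} (h : Related M (e :: es) d s t)
    (hk : M.kdom s e ∉ SecModel.sources M (e :: es) s d) (hs' : (s, s') ∈ M.step e) :
    Related M es d s' t := by
  refine ⟨h.left.step hs', h.right, ?_, fun v hv => ?_⟩
  · have hn : ¬ M.intf (M.kdom s e) M.sched := fun hi =>
      kdom_ne_sched hM h.left hk (hM.intf_sched _ hi)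
    exact (hM.equivalence _).trans
      ((hM.equivalence _).symm (hlr e _ _ _ h.left hn hs')) h.sched
  · have hn : ¬ M.intf (M.kdom s e) v := fun hi => hk (kdom_mem_sources_cons hs' hv hi)
    exact (hM.equivalence _).trans
      ((hM.equivalence _).symm (hlr e _ _ _ h.left hn hs'))
      (h.sources v (mem_sources_cons_of_mem hs' hv))

/-- Performing the same event on both sides. -/
theorem Related.step (hM : IsSecurityModel M) (hsc : ∀ e, StepConsistent M e)
    (hlr : ∀ e, LocallyRespects M e) {e : E} {es : List E} {d : D} {s t s' t' : S}
    (h : Related M (e :: es) d s t) (hs' : (s, s') ∈ M.step e) (ht' : (t, t') ∈ M.step e) :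
    Related M es d s' t' := by
  -- A domain that the event does not affect sees `s` as `s'` and `t` as `t'`.
  have key : ∀ v, M.equiv v s t → (M.intf (M.kdom s e) v → M.equiv (M.kdom s e) s t) →
      M.equiv v s' t' := by
    intro v hv hk
    by_cases hi : M.intf (M.kdom s e) v
    · exact hsc e v s t h.left h.right hv h.sched hi (hk hi) s' t' hs' ht'
    · have h₁ := hlr e v s s' h.left hi hs'
      have h₂ := hlr e v t t' h.right (h.kdom_eq hM e ▸ hi) ht'
      exact (hM.equivalence v).trans ((hM.equivalence v).symm h₁)
        ((hM.equivalence v).trans hv h₂)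
  refine ⟨h.left.step hs', h.right.step ht', key _ h.sched fun hi => ?_, fun v hv => ?_⟩
  · rw [hM.intf_sched _ hi]; exact h.sched
  · exact key v (h.sources v (mem_sources_cons_of_mem hs' hv)) fun hi =>
      h.sources _ (kdom_mem_sources_cons hs' hv hi)

theorem Related.sources_eq (hM : IsSecurityModel M) (hsc : ∀ e, StepConsistent M e)
    (hlr : ∀ e, LocallyRespects M e) {es : List E} {d : D} {s t : S} (h : Related M es d s t) :
    SecModel.sources M es s d = SecModel.sources M es t d := by
  induction es generalizing s t with
  | nil => rfl
  | cons e es ih =>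
    have heq : ∀ s' t', (s, s') ∈ M.step e → (t, t') ∈ M.step e →
        SecModel.sources M es s' d = SecModel.sources M es t' d :=
      fun s' t' hs' ht' => ih (h.step hM hsc hlr hs' ht')
    obtain ⟨s₀, hs₀⟩ := hM.enabled s e h.left
    obtain ⟨t₀, ht₀⟩ := hM.enabled t e h.right
    ext v
    constructor
    · rintro (hv | ⟨rfl, y, s', hi, hs', hy⟩)
      · simp only [Set.mem_iUnion, Set.mem_ofPred_eq, exists_prop] at hv
        obtain ⟨s', hs', hv⟩ := hv
        exact mem_sources_cons_of_mem ht₀ (heq s' t₀ hs' ht₀ ▸ hv)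
      · rw [h.kdom_eq hM] at hi ⊢
        exact kdom_mem_sources_cons ht₀ (heq s' t₀ hs' ht₀ ▸ hy) hi
    · rintro (hv | ⟨rfl, y, t', hi, ht', hy⟩)
      · simp only [Set.mem_iUnion, Set.mem_ofPred_eq, exists_prop] at hv
        obtain ⟨t', ht', hv⟩ := hv
        exact mem_sources_cons_of_mem hs₀ ((heq s₀ t' hs₀ ht').symm ▸ hv)
      · rw [← h.kdom_eq hM] at hi ⊢
        exact kdom_mem_sources_cons hs₀ ((heq s₀ t' hs₀ ht').symm ▸ hy) hi

/-- Whether an event is purged can be decided at any one state related to the members of the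
set. -/
theorem exists_kdom_mem_sources_iff (hM : IsSecurityModel M) (hsc : ∀ e, StepConsistent M e)
    (hlr : ∀ e, LocallyRespects M e) {e : E} {es : List E} {d : D} {s : S} {X : Set S}
    (hX : X.Nonempty) (h : ∀ t ∈ X, Related M (e :: es) d s t) :
    (∃ t ∈ X, M.kdom t e ∈ sources M (e :: es) t d) ↔
      M.kdom s e ∈ sources M (e :: es) s d := by
  constructor
  · rintro ⟨t, ht, hk⟩
    rwa [(h t ht).sources_eq hM hsc hlr, (h t ht).kdom_eq hM]
  · intro hk
    obtain ⟨t, ht⟩ := hX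
    exact ⟨t, ht, by rwa [← (h t ht).sources_eq hM hsc hlr, ← (h t ht).kdom_eq hM]⟩

/-- The purged sequence does not depend on the set of states among sets of states that are related
to a common state. -/
theorem ipurge_congr (hM : IsSecurityModel M) (hsc : ∀ e, StepConsistent M e)
    (hlr : ∀ e, LocallyRespects M e) {es : List E} {d : D} {s : S} {X Y : Set S}
    (hX : X.Nonempty) (hY : Y.Nonempty) (h : ∀ t ∈ X, Related M es d s t)
    (h' : ∀ t ∈ Y, Related M es d s t) : ipurge M es d X = ipurge M es d Y := by
  induction es generalizing s X Y with
  | nil => rfl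
  | cons e es ih =>
    obtain ⟨t₀, ht₀⟩ := hX
    obtain ⟨s', hs'⟩ := hM.enabled s e (h t₀ ht₀).left
    have hx := exists_kdom_mem_sources_iff hM hsc hlr ⟨t₀, ht₀⟩ h
    have hy := exists_kdom_mem_sources_iff hM hsc hlr hY h'
    by_cases hk : M.kdom s e ∈ sources M (e :: es) s d
    · rw [ipurge, ipurge, if_pos (hx.2 hk), if_pos (hy.2 hk)]
      have hne : ∀ Z : Set S, Z.Nonempty → (∀ t ∈ Z, Related M (e :: es) d s t) →
          (⋃ t ∈ Z, {t' | (t, t') ∈ M.step e}).Nonempty := by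
        rintro Z ⟨t, ht⟩ hZ
        obtain ⟨t', ht'⟩ := hM.enabled t e (hZ t ht).right
        exact ⟨t', Set.mem_biUnion ht ht'⟩
      have hrel : ∀ Z : Set S, (∀ t ∈ Z, Related M (e :: es) d s t) →
          ∀ t' ∈ ⋃ t ∈ Z, {t' | (t, t') ∈ M.step e}, Related M es d s' t' := by
        intro Z hZ t' ht'
        simp only [Set.mem_iUnion, Set.mem_ofPred_eq, exists_prop] at ht'
        obtain ⟨t, ht, ht'⟩ := ht'
        exact (hZ t ht).step hM hsc hlr hs' ht'
      rw [ih (hne X ⟨t₀, ht₀⟩ h) (hne Y hY h') (hrel X h) (hrel Y h')]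
    · rw [ipurge, ipurge, if_neg (mt hx.1 hk), if_neg (mt hy.1 hk)]
      exact ih ⟨t₀, ht₀⟩ hY (fun t ht => (h t ht).skip_left hM hlr hk hs')
        fun t ht => (h' t ht).skip_left hM hlr hk hs'

/-- Noninfluence with a set of states on the purged side, as needed for the induction. -/
theorem execEquiv_ipurge (hM : IsSecurityModel M) (hsc : ∀ e, StepConsistent M e)
    (hlr : ∀ e, LocallyRespects M e) {es : List E} {d : D} {s : S} {X : Set S}
    (h : ∀ t ∈ X, Related M es d s t) {t : S} (ht : t ∈ X) :
    ExecEquiv M d s es t (ipurge M es d X) := by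
  induction es generalizing s t X with
  | nil =>
    rintro s' ⟨⟩ t' ⟨⟩
    exact (h t ht).sources d rfl
  | cons e es ih =>
    have hx := exists_kdom_mem_sources_iff hM hsc hlr ⟨t, ht⟩ h
    rw [ipurge]
    rintro s₂ ⟨s', hs', hs₂⟩
    by_cases hk : M.kdom s e ∈ sources M (e :: es) s d
    · rw [if_pos (hx.2 hk)]
      rintro t₂ ⟨t', ht', ht₂⟩
      refine ih (fun r hr => ?_) (Set.mem_biUnion ht ht') s₂ hs₂ t₂ ht₂
      simp only [Set.mem_iUnion, Set.mem_ofPred_eq, exists_prop] at hr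
      obtain ⟨r₀, hr₀, hr⟩ := hr
      exact (h r₀ hr₀).step hM hsc hlr hs' hr
    · rw [if_neg (mt hx.1 hk)]
      exact ih (fun r hr => (h r hr).skip_left hM hlr hk hs') ht s₂ hs₂

theorem noninfluence (hM : IsSecurityModel M) (hsc : ∀ e, StepConsistent M e)
    (hlr : ∀ e, LocallyRespects M e) : Noninfluence M :=
  fun _ _ s t hs ht hsrc hsched =>
    execEquiv_ipurge hM hsc hlr (X := {t}) (by rintro _ rfl; exact ⟨hs, ht, hsched, hsrc⟩) rfl

theorem NoninterferenceR.of_noninfluence (hM : IsSecurityModel M) (h : Noninfluence M) :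
    NoninterferenceR M := fun d es s hs =>
  let hr := Related.refl hM es d hs
  h d es s s hs hs hr.sources hr.sched

/-- Two executions that are equivalent to a common one are equivalent. The common one has to have a
final state, which is where enabledness enters. -/
theorem ExecEquiv.trans_symm (hM : IsSecurityModel M) {d : D} {s t r : S} {es₁ es₂ es₃ : List E}
    (hr : Reachable M r) (h₁ : ExecEquiv M d s es₁ r es₃) (h₂ : ExecEquiv M d t es₂ r es₃) :
    ExecEquiv M d s es₁ t es₂ := by
  intro s' hs' t' ht'
  obtain ⟨r', hr'⟩ := execution_nonempty hM es₃ hr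
  exact (hM.equivalence d).trans (h₁ s' hs' r' hr')
    ((hM.equivalence d).symm (h₂ t' ht' r' hr'))

theorem weakNoninfluence (hM : IsSecurityModel M) (hsc : ∀ e, StepConsistent M e)
    (hlr : ∀ e, LocallyRespects M e) : WeakNoninfluence M := by
  intro d es₁ es₂ s t hs ht hsrc hsched hp
  have hni := noninfluence hM hsc hlr
  have hst : ipurge M es₁ d {t} = ipurge M es₂ d {t} := by
    rw [← hp]
    refine ipurge_congr hM hsc hlr (s := s) (Set.singleton_nonempty _) (Set.singleton_nonempty _)
      ?_ ?_
    · rintro _ rfl; exact ⟨hs, ht, hsched, hsrc⟩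
    · rintro _ rfl; exact Related.refl hM _ _ hs
  have h₁ := hni d es₁ s t hs ht hsrc hsched
  rw [hst] at h₁
  exact h₁.trans_symm hM ht (NoninterferenceR.of_noninfluence hM hni d es₂ t ht)

theorem nonleakage (hM : IsSecurityModel M) (hsc : ∀ e, StepConsistent M e)
    (hlr : ∀ e, LocallyRespects M e) : Nonleakage M := by
  intro d es s t hs ht hsched hsrc
  have hni := noninfluence hM hsc hlr
  exact (hni d es s t hs ht hsrc hsched).trans_symm hM ht
    (NoninterferenceR.of_noninfluence hM hni d es t ht)

theorem WeakNoninterferenceR.of_weakNoninfluence (hM : IsSecurityModel M)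
    (h : WeakNoninfluence M) : WeakNoninterferenceR M := fun d es₁ es₂ s hs hp =>
  let hr := Related.refl hM es₁ d hs
  h d es₁ es₂ s s hs hs hr.sources hr.sched hp

theorem reachable_s0 : Reachable M M.s0 := ⟨[], rfl⟩

end SecModel

/-! ### Created ports conform to the configuration -/

namespace Arinc

variable {Msg : Type u} {sc : SysConfig}

/-- The two ports agree up to the contents of their buffers. -/
structure Port.SameHeader (q q' : Port Msg) : Prop where
  name : q.name = q'.name
  dir : q.dir = q'.dir
  kind : q.IsQueuing ↔ q'.IsQueuing

theorem Port.SameHeader.refl (q : Port Msg) : q.SameHeader q := ⟨rfl, rfl, Iff.rfl⟩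

theorem Port.SameHeader.symm {q q' : Port Msg} (h : q.SameHeader q') : q'.SameHeader q :=
  ⟨h.name.symm, h.dir.symm, h.kind.symm⟩

/-- The port `q` is configured with the identifier `p` in the partition `a`. -/
structure PortConforms (sc : SysConfig) (p : PortId) (q : Port Msg) (a : PartId) : Prop where
  conf : ∃ c, sc.portconf q.name = some c ∧ c.id = p ∧ c.dir = q.dir ∧
    (c.kind = .sampling ↔ ¬ q.IsQueuing)
  mem : q.name ∈ sc.portsOf a

theorem PortConforms.congr {p : PortId} {q q' : Port Msg} {a : PartId}
    (h : PortConforms sc p q a) (hq : q'.SameHeader q) : PortConforms sc p q' a := by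
  obtain ⟨⟨c, h₁, h₂, h₃, h₄⟩, h₅⟩ := h
  exact ⟨⟨c, by rw [hq.name, h₁], h₂, by rw [h₃, hq.dir], by rw [h₄, hq.kind]⟩,
    by rw [hq.name]; exact h₅⟩

/-- Identifiers are unique, so the identifier determines the port up to its buffer. -/
theorem PortConforms.sameHeader (hsc : sc.Valid) {p : PortId} {q q' : Port Msg} {a a' : PartId}
    (h : PortConforms sc p q a) (h' : PortConforms sc p q' a') : q.SameHeader q' := by
  obtain ⟨c, h₁, h₂, h₃, h₄⟩ := h.conf
  obtain ⟨c', h₁', h₂', h₃', h₄'⟩ := h'.conf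
  have hn : q.name = q'.name := hsc.port_id _ _ _ _ h₁ h₁' (h₂.trans h₂'.symm)
  rw [hn, h₁'] at h₁
  cases h₁
  exact ⟨hn, h₃.symm.trans h₃', not_iff_not.1 (h₄.symm.trans h₄')⟩

theorem SysConfig.Valid.dir_of_isSrc (hsc : sc.Valid) {ch : Channel} (hch : ch ∈ sc.channels)
    {n : PortName} (hn : ch.IsSrc n) : ∃ c, sc.portconf n = some c ∧ c.dir = .source := by
  cases ch with
  | queuing i sn dn =>
    cases hn
    obtain ⟨c, k, h, h', -⟩ := (hsc.queuing_channel _ _ _ hch).1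
    exact ⟨c, h, h'⟩
  | sampling i sn dns =>
    cases hn
    obtain ⟨c, h, h', -⟩ := (hsc.sampling_channel _ _ _ hch).1
    exact ⟨c, h, h'⟩

theorem SysConfig.Valid.dir_of_isDst (hsc : sc.Valid) {ch : Channel} (hch : ch ∈ sc.channels)
    {n : PortName} (hn : ch.IsDst n) : ∃ c, sc.portconf n = some c ∧ c.dir = .destination := by
  cases ch with
  | queuing i sn dn =>
    cases hn
    obtain ⟨c, k, h, h', -⟩ := (hsc.queuing_channel _ _ _ hch).2
    exact ⟨c, h, h'⟩
  | sampling i sn dns =>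
    obtain ⟨c, h, h', -⟩ := (hsc.sampling_channel _ _ _ hch).2 n hn
    exact ⟨c, h, h'⟩

/-- A partition with a port that the transmitter observes may interfere with the transmitter. -/
theorem partIntfTrm_of_mem (hsc : sc.Valid) {rule : LossRule} {a : PartId} {n : PortName}
    {c : PortConf} (hn : n ∈ sc.portsOf a) (hc : sc.portconf n = some c)
    (hd : rule = .blind → c.dir = .source) : PartIntfTrm sc rule a := by
  obtain ⟨ch, hch, hs | hs⟩ := hsc.port_endpoint a n hn
  · exact ⟨n, hn, ch, hch, Or.inl hs⟩
  · refine ⟨n, hn, ch, hch, Or.inr ⟨fun hb => ?_, hs⟩⟩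
    obtain ⟨c', h, h'⟩ := hsc.dir_of_isDst hch hs
    cases hc.symm.trans h
    cases (hd hb).symm.trans h'

theorem PortConforms.partIntfTrm (hsc : sc.Valid) {rule : LossRule} {p : PortId} {q : Port Msg}
    {a : PartId} (h : PortConforms sc p q a) (hd : rule = .blind → q.dir = .source) :
    PartIntfTrm sc rule a := by
  obtain ⟨c, h₁, -, h₃, -⟩ := h.conf
  exact partIntfTrm_of_mem hsc h.mem h₁ (h₃ ▸ hd)

theorem PortConforms.trmIntfPart (hsc : sc.Valid) {p : PortId} {q : Port Msg}
    {a : PartId} (h : PortConforms sc p q a) (hd : q.dir = .destination) : TrmIntfPart sc a := by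
  obtain ⟨ch, hch, hs | hs⟩ := hsc.port_endpoint a _ h.mem
  · obtain ⟨c, h₁, -, h₃, -⟩ := h.conf
    obtain ⟨c', h, h'⟩ := hsc.dir_of_isSrc hch hs
    cases h₁.symm.trans h
    cases (h₃.symm.trans h').symm.trans hd
  · exact ⟨_, h.mem, ch, hch, hs⟩

namespace KState

/-- The invariant of reachable states: an identifier either is unused, or it is that of a created
port which belongs to its configured partition. -/
def Conforms (s : KState sc Msg) : Prop :=
  ∀ p, (s.comm p = none ∧ s.partPorts p = none) ∨
    ∃ q a, s.comm p = some q ∧ s.partPorts p = some a ∧ PortConforms sc p q a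

theorem Conforms.of_comm {s : KState sc Msg} (hs : s.Conforms) {p : PortId} {q : Port Msg}
    (h : s.comm p = some q) : ∃ a, s.partPorts p = some a ∧ PortConforms sc p q a := by
  obtain ⟨h', -⟩ | ⟨q', a, h₁, h₂, h₃⟩ := hs p
  · cases h'.symm.trans h
  · cases h₁.symm.trans h
    exact ⟨a, h₂, h₃⟩

theorem Conforms.of_partPorts {s : KState sc Msg} (hs : s.Conforms) {p : PortId} {a : PartId}
    (h : s.partPorts p = some a) : ∃ q, s.comm p = some q ∧ PortConforms sc p q a := by
  obtain ⟨-, h'⟩ | ⟨q, a', h₁, h₂, h₃⟩ := hs p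
  · cases h'.symm.trans h
  · cases h₂.symm.trans h
    exact ⟨q, h₁, h₃⟩

theorem exists_of_portIdByName {s : KState sc Msg} {n : PortName} {p : PortId}
    (h : s.portIdByName n = some p) : ∃ q, s.comm p = some q ∧ q.name = n := by
  unfold portIdByName at h
  split_ifs at h with h'
  cases h
  exact h'.choose_spec

theorem Conforms.portIdByName_eq {s : KState sc Msg} (hs : s.Conforms) {p : PortId}
    {q : Port Msg} (h : s.comm p = some q) : s.portIdByName q.name = some p := by
  have hex : ∃ p' q', s.comm p' = some q' ∧ q'.name = q.name := ⟨p, q, h, rfl⟩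
  obtain ⟨p', hp'⟩ : ∃ p', s.portIdByName q.name = some p' := by
    unfold portIdByName
    rw [dif_pos hex]
    exact ⟨_, rfl⟩
  obtain ⟨q', h₁, h₂⟩ := exists_of_portIdByName hp'
  obtain ⟨_, -, ⟨c, h₃, h₄, -⟩, -⟩ := hs.of_comm h
  obtain ⟨_, -, ⟨c', h₃', h₄', -⟩, -⟩ := hs.of_comm h₁
  rw [h₂, h₃] at h₃'
  cases h₃'
  rw [hp', ← h₄, ← h₄']

theorem Conforms.eq_none_of_portIdByName (hsc : sc.Valid) {s : KState sc Msg} (hs : s.Conforms)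
    {n : PortName} {c : PortConf} (hc : sc.portconf n = some c) (hn : s.portIdByName n = none) :
    s.comm c.id = none ∧ s.partPorts c.id = none := by
  obtain h | ⟨q, a, h₁, -, ⟨c', h₂, h₃, -⟩, -⟩ := hs c.id
  · exact h
  · rw [← hsc.port_id _ _ _ _ h₂ hc h₃, hs.portIdByName_eq h₁] at hn
    cases hn

/-- Partitions with the same ports have created the same port names. -/
theorem Conforms.portIdByName_eq_none (hsc : sc.Valid) {s t : KState sc Msg} {a : PartId}
    (hs : s.Conforms) (ht : t.Conforms) (hst : VpeqPart a s t) {n : PortName}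
    (hn : n ∈ sc.portsOf a) (h : t.portIdByName n = none) : s.portIdByName n = none := by
  by_contra hne
  obtain ⟨p, hp⟩ := Option.ne_none_iff_exists'.1 hne
  obtain ⟨q, hq, rfl⟩ := exists_of_portIdByName hp
  obtain ⟨b, hb, hc⟩ := hs.of_comm hq
  cases hsc.port_owner _ _ _ hc.mem hn
  obtain ⟨q', hq', hc'⟩ := ht.of_partPorts ((hst.2.1 p).1 hb)
  rw [(hc.sameHeader hsc hc').name, ht.portIdByName_eq hq'] at h
  cases h

theorem destMsgs_of_source {s : KState sc Msg} {p : PortId} {q : Port Msg}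
    (h : s.comm p = some q) (hd : q.dir = .source) : s.destMsgs p = none := by
  simp [destMsgs, h, hd]

theorem destMsgs_of_destination {s : KState sc Msg} {p : PortId} {q : Port Msg}
    (h : s.comm p = some q) (hd : q.dir = .destination) :
    s.destMsgs p = some q.msgs.length := by
  simp [destMsgs, h, hd]

/-! ### Updates of the buffers -/

/-- Apply `g` to all created ports. -/
def mapPorts (s : KState sc Msg) (g : PortId → Port Msg → Port Msg) : KState sc Msg :=
  { s with comm := fun p => (s.comm p).map (g p) }

@[simp] theorem mapPorts_id (s : KState sc Msg) : s.mapPorts (fun _ q => q) = s := by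
  ext1 <;> simp [mapPorts]

theorem Conforms.mapPorts {s : KState sc Msg} (hs : s.Conforms)
    {g : PortId → Port Msg → Port Msg} (hg : ∀ p q, (g p q).SameHeader q) :
    (s.mapPorts g).Conforms := by
  intro p
  obtain ⟨h, h'⟩ | ⟨q, a, h₁, h₂, h₃⟩ := hs p
  · exact Or.inl ⟨by simp [KState.mapPorts, h], h'⟩
  · exact Or.inr ⟨g p q, a, by simp [KState.mapPorts, h₁], h₂, h₃.congr (hg p q)⟩

/-- A partition observes the lengths of the buffers of its destination ports only. -/
theorem vpeqPart_mapPorts (hsc : sc.Valid) {s t : KState sc Msg} (hs : s.Conforms)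
    (ht : t.Conforms) {b : PartId} (h : VpeqPart b s t) {g g' : PortId → Port Msg → Port Msg}
    (hg : ∀ p q, (g p q).SameHeader q) (hg' : ∀ p q, (g' p q).SameHeader q)
    (hlen : ∀ p q q', s.comm p = some q → t.comm p = some q' → s.partPorts p = some b →
      PortConforms sc p q b → q.dir = .destination → q.SameHeader q' →
      q.msgs.length = q'.msgs.length → (g p q).msgs.length = (g' p q').msgs.length) :
    VpeqPart b (s.mapPorts g) (t.mapPorts g') := by
  refine ⟨h.1, h.2.1, fun p hp => ?_⟩
  obtain ⟨q, hq, hc⟩ := hs.of_partPorts hp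
  obtain ⟨q', hq', hc'⟩ := ht.of_partPorts ((h.2.1 p).1 hp)
  have hqq := hc.sameHeader hsc hc'
  have hm : (s.mapPorts g).comm p = some (g p q) := by simp [KState.mapPorts, hq]
  have hm' : (t.mapPorts g').comm p = some (g' p q') := by simp [KState.mapPorts, hq']
  cases hd : q.dir with
  | source =>
    rw [destMsgs_of_source hm ((hg p q).dir.trans hd),
      destMsgs_of_source hm' ((hg' p q').dir.trans (hqq.dir.symm.trans hd))]
  | destination =>
    have hd' := hqq.dir.symm.trans hd
    rw [destMsgs_of_destination hm ((hg p q).dir.trans hd),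
      destMsgs_of_destination hm' ((hg' p q').dir.trans hd')]
    have hl := h.2.2 p hp
    rw [destMsgs_of_destination hq hd, destMsgs_of_destination hq' hd', Option.some_inj] at hl
    rw [hlen p q q' hq hq' hp hc hd hqq hl]

/-- The transmitter observes the ports of its side, which under `blind` are the source ports. -/
theorem vpeqTrm_mapPorts {rule : LossRule} {s t : KState sc Msg} (h : VpeqTrm rule s t)
    {g g' : PortId → Port Msg → Port Msg}
    (hg : ∀ p q, (g p q).SameHeader q) (hg' : ∀ p q, (g' p q).SameHeader q)
    (heq : ∀ p q, s.comm p = some q → t.comm p = some q → (rule = .blind → q.dir = .source) →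
      g p q = g' p q) :
    VpeqTrm rule (s.mapPorts g) (t.mapPorts g') := by
  intro p hp
  have hsrc : ∀ (r : KState sc Msg) (k : PortId → Port Msg → Port Msg),
      (∀ p q, (k p q).SameHeader q) → (r.mapPorts k).IsSourcePort p → r.IsSourcePort p := by
    rintro r k hk ⟨q, hq, hd⟩
    simp only [KState.mapPorts, Option.map_eq_some_iff] at hq
    obtain ⟨q₀, hq₀, rfl⟩ := hq
    exact ⟨q₀, hq₀, (hk p q₀).dir.symm.trans hd⟩
  have hp' : rule = .blind → s.IsSourcePort p ∨ t.IsSourcePort p := fun hb =>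
    (hp hb).imp (hsrc s g hg) (hsrc t g' hg')
  obtain ⟨h₁, h₂⟩ := h p hp'
  refine ⟨h₁, ?_⟩
  simp only [KState.mapPorts]
  cases hq : s.comm p with
  | none => rw [← h₂, hq]; rfl
  | some q =>
    have hq' := h₂.symm.trans hq
    rw [hq']
    refine congrArg some (heq p q hq hq' fun hb => ?_)
    rcases hp' hb with ⟨r, hr, hd⟩ | ⟨r, hr, hd⟩
    · cases hq.symm.trans hr; exact hd
    · cases hq'.symm.trans hr; exact hd

end KState

/-! ### State equivalence -/

theorem VpeqPart.refl (a : PartId) (s : KState sc Msg) : VpeqPart a s s :=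
  ⟨rfl, fun _ => Iff.rfl, fun _ _ => rfl⟩

theorem VpeqPart.symm {a : PartId} {s t : KState sc Msg} (h : VpeqPart a s t) : VpeqPart a t s :=
  ⟨h.1.symm, fun p => (h.2.1 p).symm, fun p hp => (h.2.2 p ((h.2.1 p).2 hp)).symm⟩

theorem VpeqPart.trans {a : PartId} {s t r : KState sc Msg} (h : VpeqPart a s t)
    (h' : VpeqPart a t r) : VpeqPart a s r :=
  ⟨h.1.trans h'.1, fun p => (h.2.1 p).trans (h'.2.1 p),
    fun p hp => (h.2.2 p hp).trans (h'.2.2 p ((h.2.1 p).1 hp))⟩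

theorem VpeqTrm.refl (rule : LossRule) (s : KState sc Msg) : VpeqTrm rule s s :=
  fun _ _ => ⟨rfl, rfl⟩

theorem VpeqTrm.symm {rule : LossRule} {s t : KState sc Msg} (h : VpeqTrm rule s t) :
    VpeqTrm rule t s := fun p hp => by
  obtain ⟨h₁, h₂⟩ := h p fun hb => (hp hb).symm
  exact ⟨h₁.symm, h₂.symm⟩

theorem VpeqTrm.isSourcePort {rule : LossRule} {s t : KState sc Msg} (h : VpeqTrm rule s t)
    {p : PortId} (hp : s.IsSourcePort p) : t.IsSourcePort p := by
  obtain ⟨q, hq, hd⟩ := hp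
  exact ⟨q, (h p fun _ => Or.inl ⟨q, hq, hd⟩).2.symm.trans hq, hd⟩

theorem VpeqTrm.trans {rule : LossRule} {s t r : KState sc Msg} (h : VpeqTrm rule s t)
    (h' : VpeqTrm rule t r) : VpeqTrm rule s r := fun p hp => by
  -- A port that one of the outer states has as a source port is a source port of `t`.
  have ht : rule = .blind → t.IsSourcePort p := fun hb =>
    (hp hb).elim h.isSourcePort h'.symm.isSourcePort
  obtain ⟨h₁, h₂⟩ := h p fun hb => Or.inr (ht hb)
  obtain ⟨h₁', h₂'⟩ := h' p fun hb => Or.inl (ht hb)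
  exact ⟨h₁.trans h₁', h₂.trans h₂'⟩

theorem vpeq_equivalence (rule : LossRule) (d : Dom sc) :
    Equivalence (Vpeq (Msg := Msg) rule d) := by
  cases d with
  | part a => exact ⟨VpeqPart.refl _, VpeqPart.symm, VpeqPart.trans⟩
  | sched => exact ⟨fun _ => rfl, Eq.symm, Eq.trans⟩
  | trans => exact ⟨VpeqTrm.refl _, VpeqTrm.symm, VpeqTrm.trans⟩

/-! ### Services of the partitions -/

/-- What has to be shown of a service `F` that is executed by the partition `a`. -/
structure SecureService (rule : LossRule) (a : sc.Part)
    (F : KState sc Msg → KState sc Msg) : Prop where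
  conforms : ∀ s, s.Conforms → s.cur = .part a → (F s).Conforms
  cur : ∀ s, s.cur = .part a → (F s).cur = s.cur
  /-- Other partitions are not affected. -/
  part : ∀ s (b : sc.Part), s.Conforms → s.cur = .part a → a.1 ≠ b.1 → VpeqPart b.1 s (F s)
  /-- Without a port that the transmitter observes, the transmitter is not affected. -/
  trm : ∀ s, s.Conforms → s.cur = .part a → ¬ PartIntfTrm sc rule a.1 → VpeqTrm rule s (F s)
  part_congr : ∀ s t, s.Conforms → t.Conforms → s.cur = .part a → t.cur = .part a →
    VpeqPart a.1 s t → VpeqPart a.1 (F s) (F t)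
  trm_congr : ∀ s t, s.Conforms → t.Conforms → s.cur = .part a → t.cur = .part a →
    VpeqPart a.1 s t → VpeqTrm rule s t → VpeqTrm rule (F s) (F t)

theorem secureService_id (rule : LossRule) (a : sc.Part) :
    SecureService (Msg := Msg) rule a fun s => s where
  conforms _ h _ := h
  cur _ _ := rfl
  part _ _ _ _ _ := VpeqPart.refl _ _
  trm _ _ _ _ := VpeqTrm.refl _ _
  part_congr _ _ _ _ _ _ h := h
  trm_congr _ _ _ _ _ _ _ h := h

theorem KState.curPart_eq {s : KState sc Msg} {a : sc.Part} (h : s.cur = .part a) :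
    s.curPart = some a.1 := by
  simp [curPart, h]

theorem KState.isPortOfCur_iff {s : KState sc Msg} {a : sc.Part} (h : s.cur = .part a)
    (p : PortId) : s.IsPortOfCur p ↔ s.partPorts p = some a.1 := by
  simp [IsPortOfCur, curPart_eq h]

theorem secureService_setPartMode (rule : LossRule) (a : sc.Part) (m : PartMode) :
    SecureService (Msg := Msg) rule a fun s => setPartMode s m := by
  obtain ⟨f, key⟩ : ∃ f : Option PartMode → Option PartMode,
      ∀ s : KState sc Msg, s.cur = .part a → setPartMode s m =
        { s with partitions := Function.update s.partitions a.1 (f (s.partitions a.1)) } := by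
    classical
    refine ⟨fun o => o.map fun m₀ => if m₀ = .coldStart ∧ m = .warmStart then m₀ else m,
      fun s hs => ?_⟩
    unfold setPartMode
    rw [KState.curPart_eq hs]
    dsimp only
    cases h : s.partitions a.1 with
    | none =>
      ext1 <;> try rfl
      exact (Function.update_eq_self_iff.2 h.symm).symm
    | some m₀ =>
      dsimp only [Option.map_some]
      split_ifs
      · ext1 <;> try rfl
        exact (Function.update_eq_self_iff.2 h.symm).symm
      · rfl
  refine ⟨fun s hc hs => ?_, fun s hs => ?_, fun s b hc hs hab => ?_, fun s hc hs hn => ?_,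
    fun s t hcs hct hs ht h => ?_, fun s t hcs hct hs ht h h' => ?_⟩
  all_goals simp only [key s hs]
  · exact hc
  · exact ⟨by simp [Function.update_of_ne hab.symm], fun _ => Iff.rfl, fun _ _ => rfl⟩
  · exact fun _ _ => ⟨rfl, rfl⟩
  · rw [key t ht]
    exact ⟨by simp [h.1], h.2⟩
  · rw [key t ht]
    exact h'

/-- An operation on a single port that keeps the header, and whose effect on the length of the
buffer depends on the header and that length only. -/
structure PortOp (f : Port Msg → Port Msg) : Prop where
  header : ∀ q, (f q).SameHeader q
  length : ∀ q q', q.SameHeader q' → q.msgs.length = q'.msgs.length →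
    (f q).msgs.length = (f q').msgs.length

open Classical in
/-- Apply an operation to a port of the current partition that has the given direction. -/
noncomputable def modifyOwnPort (δ : PortDir) (p : PortId) (f : Port Msg → Port Msg)
    (s : KState sc Msg) : KState sc Msg :=
  s.mapPorts fun p' q => if p' = p ∧ q.dir = δ ∧ s.IsPortOfCur p then f q else q

theorem secureService_modifyOwnPort (hsc : sc.Valid) (rule : LossRule) (a : sc.Part)
    (δ : PortDir) (p : PortId) {f : Port Msg → Port Msg} (hf : PortOp f) :
    SecureService rule a (modifyOwnPort (sc := sc) δ p f) := by
  classical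
  have hg : ∀ (P : PortId → Port Msg → Prop) [∀ p q, Decidable (P p q)],
      ∀ p q, (if P p q then f q else q).SameHeader q := by
    intro P _ p q
    split_ifs
    · exact hf.header q
    · exact Port.SameHeader.refl q
  refine ⟨fun s hc hs => hc.mapPorts (hg _), fun s hs => rfl, fun s b hc hs hab => ?_,
    fun s hc hs hn => ?_, fun s t hcs hct hs ht h => ?_, fun s t hcs hct hs ht h h' => ?_⟩
  · conv => arg 2; rw [← s.mapPorts_id]
    refine KState.vpeqPart_mapPorts hsc hc hc (VpeqPart.refl _ _)
      (fun _ _ => Port.SameHeader.refl _) (hg _) fun p' q q' hq hq' hp _ _ _ hl => ?_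
    rw [hl, if_neg]
    rintro ⟨rfl, -, h⟩
    rw [KState.isPortOfCur_iff hs, hp, Option.some_inj] at h
    exact hab h.symm
  · conv => arg 2; rw [← s.mapPorts_id]
    refine KState.vpeqTrm_mapPorts (VpeqTrm.refl _ _)
      (fun _ _ => Port.SameHeader.refl _) (hg _) fun p' q hq _ hb => ?_
    rw [if_neg]
    rintro ⟨rfl, -, h⟩
    obtain ⟨q', hq', hc'⟩ := hc.of_partPorts ((KState.isPortOfCur_iff hs _).1 h)
    cases hq.symm.trans hq'
    exact hn (hc'.partIntfTrm hsc hb)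
  · refine KState.vpeqPart_mapPorts hsc hcs hct h (hg _) (hg _)
      fun p' q q' hq hq' hp _ _ hqq hl => ?_
    simp only [hqq.dir, KState.isPortOfCur_iff hs, KState.isPortOfCur_iff ht, h.2.1]
    split_ifs
    · exact hf.length q q' hqq hl
    · exact hl
  · refine KState.vpeqTrm_mapPorts h' (hg _) (hg _) fun p' q hq hq' hb => ?_
    simp only [KState.isPortOfCur_iff hs, KState.isPortOfCur_iff ht, h.2.1]

/-- Create the port `q` with the identifier `p` in the partition `a`. -/
def addPort (a : PartId) (p : PortId) (q : Port Msg) (s : KState sc Msg) : KState sc Msg :=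
  { s with
    partPorts := Function.update s.partPorts p (some a)
    comm := Function.update s.comm p (some q) }

theorem destMsgs_addPort (a : PartId) (p : PortId) (q : Port Msg) (s : KState sc Msg)
    (p' : PortId) : (addPort a p q s).destMsgs p' =
      if p' = p then (match q.dir with | .destination => some q.msgs.length | .source => none)
      else s.destMsgs p' := by
  by_cases h : p' = p
  · subst h
    cases hd : q.dir <;> simp [KState.destMsgs, addPort, hd]
  · simp [KState.destMsgs, addPort, h]

theorem secureService_createPort (hsc : sc.Valid) (rule : LossRule) (a : sc.Part) (n : PortName)
    {ok : PortKind → Prop} {new : PortDir → Port Msg}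
    (hnew : ∀ k d, ok k →
      (new d).name = n ∧ (new d).dir = d ∧ (k = .sampling ↔ ¬ (new d).IsQueuing)) :
    SecureService rule a fun s : KState sc Msg => (createPort s n ok new).1 := by
  -- The service either adds the port or does nothing.
  have key : ∀ s : KState sc Msg, s.Conforms → s.cur = .part a →
      ((createPort s n ok new).1 = s ∧ ∀ c, sc.portconf n = some c → n ∈ sc.portsOf a.1 →
        ok c.kind → s.portIdByName n ≠ none) ∨
      ∃ c, sc.portconf n = some c ∧ ok c.kind ∧ n ∈ sc.portsOf a.1 ∧ s.portIdByName n = none ∧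
        PortConforms sc c.id (new c.dir) a.1 ∧ s.comm c.id = none ∧ s.partPorts c.id = none ∧
        (createPort s n ok new).1 = addPort a.1 c.id (new c.dir) s := by
    intro s hc hs
    unfold createPort
    rw [KState.curPart_eq hs]
    cases h : sc.portconf n with
    | none => exact Or.inl ⟨rfl, fun c h => by cases h⟩
    | some c =>
      dsimp only
      split_ifs with h'
      · obtain ⟨h₁, h₂, h₃⟩ := h'
        obtain ⟨hn₁, hn₂, hn₃⟩ := hnew c.kind c.dir h₁
        obtain ⟨h₄, h₅⟩ := hc.eq_none_of_portIdByName hsc h h₃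
        exact Or.inr ⟨c, rfl, h₁, h₂, h₃,
          ⟨⟨c, by rw [hn₁, h], rfl, hn₂.symm, hn₃⟩, by rwa [hn₁]⟩, h₄, h₅, rfl⟩
      · refine Or.inl ⟨rfl, ?_⟩
        rintro _ ⟨⟩ h₁ h₂ h₃
        exact h' ⟨h₂, h₁, h₃⟩
  -- Partition-equivalent states take the same branch.
  have key₂ : ∀ s t : KState sc Msg, s.Conforms → t.Conforms → s.cur = .part a →
      t.cur = .part a → VpeqPart a.1 s t →
      ((createPort s n ok new).1 = s ∧ (createPort t n ok new).1 = t) ∨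
      ∃ c : PortConf, PortConforms sc c.id (new c.dir) a.1 ∧
        (createPort s n ok new).1 = addPort a.1 c.id (new c.dir) s ∧
        (createPort t n ok new).1 = addPort a.1 c.id (new c.dir) t := by
    intro s t hcs hct hs ht h
    obtain ⟨h₁, h₂⟩ | ⟨c, h₁, h₂, h₃, h₄, h₅, -, -, h₆⟩ := key s hcs hs <;>
    obtain ⟨h₁', h₂'⟩ | ⟨c', h₁', h₂', h₃', h₄', -, -, -, h₆'⟩ := key t hct ht
    · exact Or.inl ⟨h₁, h₁'⟩
    · exact absurd (hcs.portIdByName_eq_none hsc hct h h₃' h₄') (h₂ c' h₁' h₃' h₂')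
    · exact absurd (hct.portIdByName_eq_none hsc hcs h.symm h₃ h₄) (h₂' c h₁ h₃ h₂)
    · cases h₁.symm.trans h₁'
      exact Or.inr ⟨c, h₅, h₆, h₆'⟩
  refine ⟨fun s hc hs => ?_, fun s hs => ?_, fun s b hc hs hab => ?_,
    fun s hc hs hn => ?_, fun s t hcs hct hs ht h => ?_, fun s t hcs hct hs ht h h' => ?_⟩
  · obtain ⟨h, -⟩ | ⟨c, -, -, -, -, hp, -, -, h⟩ := key s hc hs
    · rwa [h]
    · rw [h]
      intro p
      by_cases hpc : p = c.id
      · subst hpc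
        exact Or.inr ⟨_, a.1, by simp [addPort], by simp [addPort], hp⟩
      · simpa [addPort, hpc] using hc p
  · unfold createPort
    split
    · split_ifs <;> rfl
    · rfl
  · obtain ⟨h, -⟩ | ⟨c, -, -, -, -, hp, -, hno, h⟩ := key s hc hs
    · rw [h]; exact VpeqPart.refl _ _
    · rw [h]
      refine ⟨rfl, fun p => ?_, fun p hp => ?_⟩
      · by_cases hpc : p = c.id
        · subst hpc
          simpa [addPort, hno] using hab
        · simp [addPort, hpc]
      · rw [destMsgs_addPort, if_neg]
        rintro rfl
        cases hno.symm.trans hp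
  · obtain ⟨h, -⟩ | ⟨c, -, -, -, -, hp, hco, -, h⟩ := key s hc hs
    · rw [h]; exact VpeqTrm.refl _ _
    · rw [h]
      intro p hb
      by_cases hpc : p = c.id
      · subst hpc
        refine absurd (hp.partIntfTrm hsc fun hr => ?_) hn
        obtain ⟨q, hq, -⟩ | ⟨q, hq, hd⟩ := hb hr
        · cases hco.symm.trans hq
        · simp only [addPort, Function.update_self] at hq
          cases hq
          exact hd
      · simp [addPort, hpc]
  · obtain ⟨h₁, h₂⟩ | ⟨c, -, h₁, h₂⟩ := key₂ s t hcs hct hs ht h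
    · rwa [h₁, h₂]
    · rw [h₁, h₂]
      refine ⟨h.1, fun p => ?_, fun p hp => ?_⟩
      · by_cases hpc : p = c.id
        · simp [addPort, hpc]
        · simpa [addPort, hpc] using h.2.1 p
      · rw [destMsgs_addPort, destMsgs_addPort]
        split_ifs with hpc
        · rfl
        · simp only [addPort, Function.update_of_ne hpc] at hp
          exact h.2.2 p hp
  · obtain ⟨h₁, h₂⟩ | ⟨c, -, h₁, h₂⟩ := key₂ s t hcs hct hs ht h
    · rwa [h₁, h₂]
    · rw [h₁, h₂]
      intro p hb
      by_cases hpc : p = c.id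
      · simp [addPort, hpc]
      · simp only [addPort, Function.update_of_ne hpc]
        refine h' p fun hr => ?_
        simpa [addPort, KState.IsSourcePort, hpc] using hb hr

/-! ### Operations on single ports -/

namespace Port

theorem SameHeader.trans {q q' q'' : Port Msg} (h : q.SameHeader q') (h' : q'.SameHeader q'') :
    q.SameHeader q'' :=
  ⟨h.name.trans h'.name, h.dir.trans h'.dir, h.kind.trans h'.kind⟩

/-- The buffer of a queuing port is full. -/
def IsFull (sc : SysConfig) (q : Port Msg) : Prop :=
  ∃ n d b c k, q = .queuing n d b ∧ sc.portconf n = some c ∧ c.kind = .queuing k ∧ k ≤ b.length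

theorem IsFull.congr {q q' : Port Msg} (h : q.IsFull sc) (hq : q.SameHeader q')
    (hl : q.msgs.length = q'.msgs.length) : q'.IsFull sc := by
  obtain ⟨n, d, b, c, k, rfl, h₁, h₂, h₃⟩ := h
  cases q' with
  | queuing n' d' b' =>
    cases hq.name
    exact ⟨n, d', b', c, k, rfl, h₁, h₂, hl ▸ h₃⟩
  | sampling n' d' b' => exact (hq.kind.1 trivial).elim

/-- Replace the message of a sampling port. -/
def write (m : Msg) : Port Msg → Port Msg
  | .sampling n d _ => .sampling n d (some m)
  | q => q

/-- Append a message to the buffer of a queuing port. -/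
def append (m : Msg) : Port Msg → Port Msg
  | .queuing n d b => .queuing n d (b ++ [m])
  | q => q

/-- Remove the oldest message from the buffer of a queuing port. -/
def tail : Port Msg → Port Msg
  | .queuing n d b => .queuing n d b.tail
  | q => q

/-- Empty the buffer of a queuing port. -/
def clear : Port Msg → Port Msg
  | .queuing n d _ => .queuing n d []
  | q => q

open Classical in
/-- Append a message unless the buffer is full. -/
noncomputable def send (sc : SysConfig) (m : Msg) (q : Port Msg) : Port Msg :=
  if q.IsFull sc then q else q.append m

open Classical in
/-- The effect on a port of the transmission of the message `m`, if there is one, to the sampling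
ports named in `dns`. -/
noncomputable def deliver (dns : Set PortName) (m : Option Msg) : Port Msg → Port Msg
  | .sampling n d b => .sampling n d (if n ∈ dns then m.or b else b)
  | q => q

end Port

theorem portOp_write (m : Msg) : PortOp (Port.write m) where
  header q := by cases q <;> exact ⟨rfl, rfl, Iff.rfl⟩
  length q q' h hl := by
    obtain ⟨-, -, hk⟩ := h
    cases q <;> cases q' <;> simp_all [Port.write, Port.msgs, Port.IsQueuing]

theorem portOp_append (m : Msg) : PortOp (Port.append m) where
  header q := by cases q <;> exact ⟨rfl, rfl, Iff.rfl⟩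
  length q q' h hl := by
    obtain ⟨-, -, hk⟩ := h
    cases q <;> cases q' <;> simp_all [Port.append, Port.msgs, Port.IsQueuing]

theorem portOp_tail : PortOp (Port.tail (Msg := Msg)) where
  header q := by cases q <;> exact ⟨rfl, rfl, Iff.rfl⟩
  length q q' h hl := by
    obtain ⟨-, -, hk⟩ := h
    cases q <;> cases q' <;> simp_all [Port.tail, Port.msgs, Port.IsQueuing]

theorem portOp_clear : PortOp (Port.clear (Msg := Msg)) where
  header q := by cases q <;> exact ⟨rfl, rfl, Iff.rfl⟩
  length q q' h hl := by
    obtain ⟨-, -, hk⟩ := h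
    cases q <;> cases q' <;> simp_all [Port.clear, Port.msgs, Port.IsQueuing]

theorem portOp_send (m : Msg) : PortOp (Port.send sc m) where
  header q := by
    unfold Port.send
    split_ifs
    · exact Port.SameHeader.refl _
    · exact (portOp_append m).header q
  length q q' h hl := by
    have hiff : q.IsFull sc ↔ q'.IsFull sc :=
      ⟨fun hf => hf.congr h hl, fun hf => hf.congr h.symm hl.symm⟩
    by_cases hf : q.IsFull sc
    · rwa [Port.send, Port.send, if_pos hf, if_pos (hiff.1 hf)]
    · rw [Port.send, Port.send, if_neg hf, if_neg (mt hiff.2 hf)]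
      exact (portOp_append m).length q q' h hl

theorem portOp_deliver (dns : Set PortName) (m : Option Msg) : PortOp (Port.deliver dns m) where
  header q := by cases q <;> exact ⟨rfl, rfl, Iff.rfl⟩
  length q q' h hl := by
    obtain ⟨hn, -, hk⟩ := h
    rcases q with ⟨n, d, b⟩ | ⟨n, d, b⟩ <;> rcases q' with ⟨n', d', b'⟩ | ⟨n', d', b'⟩
    · exact hl
    · exact (hk.1 trivial).elim
    · exact (hk.2 trivial).elim
    · obtain rfl : n = n' := hn
      by_cases h : n ∈ dns
      · cases m <;> simp_all [Port.deliver, Port.msgs]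
      · simpa [Port.deliver, Port.msgs, h] using hl

/-! ### Hypercalls -/

theorem KState.isFullQueuing_iff {s : KState sc Msg} {p : PortId} {q : Port Msg}
    (h : s.comm p = some q) : s.IsFullQueuing sc p ↔ q.IsFull sc := by
  simp [KState.IsFullQueuing, Port.IsFull, h]

theorem modifyOwnPort_eq_setPort {δ : PortDir} {p : PortId} {f : Port Msg → Port Msg}
    {s : KState sc Msg} {q : Port Msg} (hq : s.comm p = some q) (hd : q.dir = δ)
    (hp : s.IsPortOfCur p) : modifyOwnPort δ p f s = s.setPort p (f q) := by
  ext1 <;> try rfl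
  funext p'
  by_cases h : p' = p
  · subst h
    simp [modifyOwnPort, KState.mapPorts, KState.setPort, hq, hd, hp]
  · simp [modifyOwnPort, KState.mapPorts, KState.setPort, h]

theorem modifyOwnPort_eq_self {δ : PortDir} {p : PortId} {f : Port Msg → Port Msg}
    {s : KState sc Msg}
    (h : ∀ q, s.comm p = some q → q.dir = δ → s.IsPortOfCur p → f q = q) :
    modifyOwnPort δ p f s = s := by
  ext1 <;> try rfl
  funext p'
  simp only [modifyOwnPort, KState.mapPorts]
  cases hq : s.comm p' with
  | none => rfl
  | some q =>
    rw [Option.map_some]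
    split_ifs with hc
    · obtain ⟨rfl, hd, hp⟩ := hc
      rw [h q hq hd hp]
    · rfl

theorem KState.setPort_self {s : KState sc Msg} {p : PortId} {q : Port Msg}
    (h : s.comm p = some q) : s.setPort p q = s := by
  ext1 <;> try rfl
  exact Function.update_eq_self_iff.2 h.symm

theorem writeSamplingMsg_fst (s : KState sc Msg) (p : PortId) (m : Msg) :
    (writeSamplingMsg s p m).1 = modifyOwnPort .source p (Port.write m) s := by
  unfold writeSamplingMsg
  split_ifs with h
  · refine Eq.symm <| modifyOwnPort_eq_self fun q (hq : s.comm p = _) hd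
      (hp : s.IsPortOfCur p) => ?_
    cases q with
    | queuing => rfl
    | sampling => exact absurd h (by simp [KState.IsSamplingPort, KState.IsSourcePort, hq, hd, hp,
        Port.IsQueuing])
  · simp only [not_or, not_not] at h
    obtain ⟨⟨q, hq, hk⟩, ⟨q', hq', hd⟩, hp⟩ := h
    cases hq.symm.trans hq'
    rw [modifyOwnPort_eq_setPort hq hd hp, hq]
    cases q with
    | queuing => exact absurd trivial hk
    | sampling => rfl

theorem sendQueuingMsgLost_fst (s : KState sc Msg) (p : PortId) (m : Msg) :
    (sendQueuingMsgLost s p m).1 = modifyOwnPort .source p (Port.send sc m) s := by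
  unfold sendQueuingMsgLost
  split_ifs with h h'
  · refine Eq.symm <| modifyOwnPort_eq_self fun q (hq : s.comm p = _) hd
      (hp : s.IsPortOfCur p) => ?_
    cases q with
    | queuing => exact absurd h (by simp [KState.IsQueuingPort, KState.IsSourcePort, hq, hd, hp,
        Port.IsQueuing])
    | sampling => exact ite_self _
  · refine Eq.symm <| modifyOwnPort_eq_self fun q (hq : s.comm p = _) hd
      (hp : s.IsPortOfCur p) => ?_
    exact if_pos ((KState.isFullQueuing_iff hq).1 h')
  · simp only [not_or, not_not] at h
    obtain ⟨⟨q, hq, hk⟩, ⟨q', hq', hd⟩, hp⟩ := h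
    cases hq.symm.trans hq'
    rw [modifyOwnPort_eq_setPort hq hd hp, Port.send,
      if_neg (mt (KState.isFullQueuing_iff hq).2 h')]
    cases q with
    | queuing => simp [KState.insertMsg, hq, Port.append]
    | sampling => exact hk.elim

theorem KState.removeMsg_fst {s : KState sc Msg} {p : PortId} {q : Port Msg}
    (hq : s.comm p = some q) : (s.removeMsg p).1 = s.setPort p q.tail := by
  rcases q with ⟨n, d, _ | ⟨m, b⟩⟩ | ⟨n, d, b⟩
  · simp [removeMsg, hq, Port.tail, setPort_self hq]
  · simp [removeMsg, hq, Port.tail]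
  · simp [removeMsg, hq, Port.tail, setPort_self hq]

theorem receiveQueuingMsg_fst (s : KState sc Msg) (p : PortId) :
    (receiveQueuingMsg s p).1 = modifyOwnPort .destination p Port.tail s := by
  unfold receiveQueuingMsg
  split_ifs with h
  · refine Eq.symm <| modifyOwnPort_eq_self fun q (hq : s.comm p = _) hd
      (hp : s.IsPortOfCur p) => ?_
    cases q with
    | queuing => exact absurd h (by simp [KState.IsQueuingPort, KState.IsDestPort, hq, hd, hp,
        Port.IsQueuing])
    | sampling => rfl
  · simp only [not_or, not_not] at h
    obtain ⟨-, ⟨q, hq, hd⟩, hp⟩ := h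
    rw [modifyOwnPort_eq_setPort hq hd hp, KState.removeMsg_fst hq]

theorem clearQueuingPort_fst (s : KState sc Msg) (p : PortId) :
    (clearQueuingPort s p).1 = modifyOwnPort .destination p Port.clear s := by
  unfold clearQueuingPort
  split_ifs with h
  · refine Eq.symm <| modifyOwnPort_eq_self fun q (hq : s.comm p = _) hd
      (hp : s.IsPortOfCur p) => ?_
    cases q with
    | queuing => exact absurd h (by simp [KState.IsQueuingPort, KState.IsDestPort, hq, hd, hp,
        Port.IsQueuing])
    | sampling => rfl
  · simp only [not_or, not_not] at h
    obtain ⟨⟨q, hq, hk⟩, ⟨q', hq', hd⟩, hp⟩ := h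
    cases hq.symm.trans hq'
    rw [modifyOwnPort_eq_setPort hq hd hp, hq]
    cases q with
    | queuing => rfl
    | sampling => exact hk.elim

theorem getPortId_fst (s : KState sc Msg) (n : PortName) : (getPortId s n).1 = s := by
  unfold getPortId
  split
  · split_ifs <;> rfl
  · rfl

theorem secureService_execHypercall (hsc : sc.Valid) (rule : LossRule) (a : sc.Part)
    (h : Hypercall Msg) : SecureService rule a fun s : KState sc Msg => execHypercall s h := by
  cases h with
  | createSamplingPort n =>
    refine secureService_createPort hsc rule a n fun k d hk => ⟨rfl, rfl, ?_⟩
    simp [hk, Port.IsQueuing]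
  | createQueuingPort n =>
    refine secureService_createPort hsc rule a n fun k d hk => ⟨rfl, rfl, ?_⟩
    obtain ⟨c, rfl⟩ := hk
    simp [Port.IsQueuing]
  | writeSamplingMessage p m =>
    simp only [execHypercall, writeSamplingMsg_fst]
    exact secureService_modifyOwnPort hsc rule a _ p (portOp_write m)
  | sendQueuingMessage p m =>
    simp only [execHypercall, sendQueuingMsgLost_fst]
    exact secureService_modifyOwnPort hsc rule a _ p (portOp_send m)
  | receiveQueuingMessage p =>
    simp only [execHypercall, receiveQueuingMsg_fst]
    exact secureService_modifyOwnPort hsc rule a _ p portOp_tail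
  | clearQueuingPort p =>
    simp only [execHypercall, clearQueuingPort_fst]
    exact secureService_modifyOwnPort hsc rule a _ p portOp_clear
  | setPartitionMode m => exact secureService_setPartMode rule a m
  | readSamplingMessage p =>
    have : ∀ s : KState sc Msg, (readSamplingMsg s p).1 = s := fun s => by
      unfold readSamplingMsg; split_ifs <;> rfl
    simp only [execHypercall, this]
    exact secureService_id rule a
  | getSamplingPortId n =>
    simp only [execHypercall, getPortId_fst]
    exact secureService_id rule a
  | getQueuingPortId n =>
    simp only [execHypercall, getPortId_fst]
    exact secureService_id rule a
  | getSamplingPortStatus p | getQueuingPortStatus p =>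
    have : ∀ s : KState sc Msg, (getPortStatus s p).1 = s := fun s => by
      unfold getPortStatus; split_ifs <;> rfl
    simp only [execHypercall, this]
    exact secureService_id rule a
  | getPartitionStatus => exact secureService_id rule a

/-! ### Transmissions -/

/-- What has to be shown of a transmission `F`. -/
structure SecureTransmission (rule : LossRule) (F : KState sc Msg → KState sc Msg) : Prop where
  conforms : ∀ s, s.Conforms → (F s).Conforms
  cur : ∀ s, s.Conforms → (F s).cur = s.cur
  /-- Partitions without destination ports are not affected. -/
  part : ∀ s b, s.Conforms → ¬ TrmIntfPart sc b → VpeqPart b s (F s)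
  part_congr : ∀ s t b, s.Conforms → t.Conforms → VpeqTrm rule s t →
    VpeqPart b s t → VpeqPart b (F s) (F t)
  trm_congr : ∀ s t, s.Conforms → t.Conforms → VpeqTrm rule s t → VpeqTrm rule (F s) (F t)

theorem secureTransmission_id (rule : LossRule) :
    SecureTransmission (sc := sc) (Msg := Msg) rule fun s => s where
  conforms _ h := h
  cur _ _ := rfl
  part _ _ _ _ := VpeqPart.refl _ _
  part_congr _ _ _ _ _ _ h := h
  trm_congr _ _ _ _ h := h

/-- A transmission that updates the buffers is secure if its effect `g` on the ports that the
transmitter observes, and on the lengths of the destination buffers, is determined by what the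
transmitter and the owner observe. -/
theorem secureTransmission_of_mapPorts (hsc : sc.Valid) {rule : LossRule}
    {F : KState sc Msg → KState sc Msg} {g : KState sc Msg → Port Msg → Port Msg}
    (hF : ∀ s, s.Conforms → F s = s.mapPorts fun _ => g s)
    (hg : ∀ s q, (g s q).SameHeader q)
    (htrm : ∀ s t p q, s.Conforms → t.Conforms → VpeqTrm rule s t → s.comm p = some q →
      (rule = .blind → q.dir = .source) → g s q = g t q)
    (hlen : ∀ s t p q q', s.Conforms → t.Conforms → VpeqTrm rule s t → s.comm p = some q →
      t.comm p = some q' → q.dir = .destination → q.SameHeader q' →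
      q.msgs.length = q'.msgs.length → (g s q).msgs.length = (g t q').msgs.length) :
    SecureTransmission rule F where
  conforms s hs := by rw [hF s hs]; exact hs.mapPorts fun _ => hg s
  cur s hs := by rw [hF s hs]; rfl
  part s b hs hb := by
    rw [hF s hs]
    conv => arg 2; rw [← s.mapPorts_id]
    exact KState.vpeqPart_mapPorts hsc hs hs (VpeqPart.refl _ _)
      (fun _ _ => Port.SameHeader.refl _) (fun _ => hg s)
      fun p q q' _ _ _ hc hd _ _ => absurd (hc.trmIntfPart hsc hd) hb
  part_congr s t b hs ht h h' := by
    rw [hF s hs, hF t ht]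
    exact KState.vpeqPart_mapPorts hsc hs ht h' (fun _ => hg s) (fun _ => hg t)
      fun p q q' hq hq' _ _ hd hqq hl => hlen s t p q q' hs ht h hq hq' hd hqq hl
  trm_congr s t hs ht h := by
    rw [hF s hs, hF t ht]
    exact KState.vpeqTrm_mapPorts h (fun _ => hg s) (fun _ => hg t)
      fun p q hq _ hb => htrm s t p q hs ht h hq hb

namespace KState

/-- The created port with a given name. -/
noncomputable def portByName (s : KState sc Msg) (n : PortName) : Option (Port Msg) :=
  (s.portIdByName n).bind s.comm

theorem Conforms.portByName_eq_some_iff {s : KState sc Msg} (hs : s.Conforms) {n : PortName}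
    {q : Port Msg} : s.portByName n = some q ↔ ∃ p, s.comm p = some q ∧ q.name = n := by
  constructor
  · intro h
    obtain ⟨p, hp, hq⟩ := Option.bind_eq_some_iff.1 h
    obtain ⟨q', hq', hn⟩ := exists_of_portIdByName hp
    cases hq.symm.trans hq'
    exact ⟨p, hq, hn⟩
  · rintro ⟨p, hq, rfl⟩
    rw [portByName, hs.portIdByName_eq hq, Option.bind_some, hq]

theorem Conforms.dir_eq {s : KState sc Msg} (hs : s.Conforms) {p : PortId} {q : Port Msg}
    {c : PortConf} (hq : s.comm p = some q) (hc : sc.portconf q.name = some c) :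
    q.dir = c.dir := by
  obtain ⟨_, -, ⟨c', h₁, -, h₃, -⟩, -⟩ := hs.of_comm hq
  cases h₁.symm.trans hc
  exact h₃.symm

/-- The transmitter finds the same port for a name whose port it observes. -/
theorem Conforms.portByName_congr {rule : LossRule} {s t : KState sc Msg} (hs : s.Conforms)
    (ht : t.Conforms) (h : VpeqTrm rule s t) {n : PortName}
    (hn : rule = .blind → ∃ c, sc.portconf n = some c ∧ c.dir = .source) :
    s.portByName n = t.portByName n := by
  have key : ∀ {s t : KState sc Msg}, s.Conforms → t.Conforms → VpeqTrm rule s t → ∀ q,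
      s.portByName n = some q → t.portByName n = some q := by
    intro s t hs ht h q hq
    obtain ⟨p, hp, rfl⟩ := hs.portByName_eq_some_iff.1 hq
    refine ht.portByName_eq_some_iff.2 ⟨p, ?_, rfl⟩
    rw [← hp]
    refine (h p fun hb => Or.inl ⟨q, hp, ?_⟩).2.symm
    obtain ⟨c, hc, hd⟩ := hn hb
    exact (hs.dir_eq hp hc).trans hd
  exact Option.ext fun q => ⟨key hs ht h q, key ht hs h.symm q⟩

end KState

theorem secureTransmission_transfSamplingMsg (hsc : sc.Valid) (rule : LossRule) {ch : Channel}
    (hch : ch ∈ sc.channels) :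
    SecureTransmission rule fun s : KState sc Msg => transfSamplingMsg s ch := by
  cases ch with
  | queuing => exact secureTransmission_id rule
  | sampling i sn dns =>
    have hsrc := hsc.dir_of_isSrc hch (n := sn) rfl
    have hcongr : ∀ {s t : KState sc Msg}, s.Conforms → t.Conforms → VpeqTrm rule s t →
        s.portByName sn = t.portByName sn :=
      fun hs ht h => hs.portByName_congr ht h fun _ => hsrc
    refine secureTransmission_of_mapPorts hsc
      (g := fun s => Port.deliver dns ((s.portByName sn).bind fun q => q.msgs.head?))
      (fun s hs => ?_) (fun s q => (portOp_deliver _ _).header q)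
      (fun s t p q hs ht h _ _ => by rw [hcongr hs ht h])
      (fun s t p q q' hs ht h _ _ _ hqq hl => by
        rw [hcongr hs ht h]; exact (portOp_deliver _ _).length q q' hqq hl)
    have hnone : Port.deliver (Msg := Msg) dns none = fun q => q := by
      funext q
      cases q <;> simp [Port.deliver]
    simp only [transfSamplingMsg, KState.portByName]
    cases hp : s.portIdByName sn with
    | none => simp [hnone]
    | some sp =>
      obtain ⟨q, hq, -⟩ := KState.exists_of_portIdByName hp
      simp only [KState.portMsgs, hq, Option.bind_some]
      cases q.msgs.head? with
      | none => simp [hnone]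
      | some m =>
        simp only [KState.mapPorts]
        congr! with p q
        cases q <;> simp [Port.deliver]

open Classical in
/-- Apply an operation to the port with a given name. -/
noncomputable def atName (n : PortName) (f : Port Msg → Port Msg) (q : Port Msg) : Port Msg :=
  if q.name = n then f q else q

theorem atName_header {n : PortName} {f : Port Msg → Port Msg} (hf : PortOp f) (q : Port Msg) :
    (atName n f q).SameHeader q := by
  unfold atName
  split_ifs
  · exact hf.header q
  · exact Port.SameHeader.refl q

theorem atName_of_ne {n : PortName} {f : Port Msg → Port Msg} {q : Port Msg} (h : q.name ≠ n) :
    atName n f q = q := if_neg h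

theorem KState.Conforms.mapPorts_atName {s : KState sc Msg} (hs : s.Conforms) {p : PortId}
    {q : Port Msg} (hq : s.comm p = some q) (f : Port Msg → Port Msg) :
    s.mapPorts (fun _ => atName q.name f) = s.setPort p (f q) := by
  ext1 <;> try rfl
  funext p'
  simp only [KState.mapPorts, KState.setPort]
  by_cases h : p' = p
  · subst h
    simp [hq, atName]
  · rw [Function.update_of_ne h]
    cases hq' : s.comm p' with
    | none => rfl
    | some q' =>
      rw [Option.map_some, atName_of_ne]
      intro hn
      have h₁ := hs.portIdByName_eq hq'
      rw [hn, hs.portIdByName_eq hq] at h₁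
      exact h (Option.some_inj.1 h₁).symm

theorem KState.insertMsg_eq {s : KState sc Msg} {p : PortId} {q : Port Msg}
    (hq : s.comm p = some q) (m : Msg) : s.insertMsg p m = s.setPort p (q.append m) := by
  cases q with
  | queuing => simp [insertMsg, hq, Port.append]
  | sampling => simp [insertMsg, hq, Port.append, setPort_self hq]

open Classical in
/-- The effect on a port of a transmission from `sn` to `dn`, where `src` and `dst` are the created
ports with these names. -/
noncomputable def queueEffect (sc : SysConfig) (rule : LossRule) (sn dn : PortName)
    (src dst : Option (Port Msg)) (r : Port Msg) : Port Msg :=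
  match src with
  | some (.queuing _ _ (m :: _)) =>
    match dst with
    | none => if rule = .blind then atName sn Port.tail r else r
    | some q =>
      if q.IsFull sc then (if rule = .hold then r else atName sn Port.tail r)
      else atName dn (Port.append m) (atName sn Port.tail r)
  | _ => r

section queueEffect

variable {rule : LossRule} {sn dn : PortName} {src dst : Option (Port Msg)}

theorem queueEffect_header (q : Port Msg) :
    (queueEffect sc rule sn dn src dst q).SameHeader q := by
  unfold queueEffect
  split
  · split
    · split_ifs
      · exact atName_header portOp_tail q
      · exact Port.SameHeader.refl q
    · split_ifs
      · exact Port.SameHeader.refl q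
      · exact atName_header portOp_tail q
      · exact (atName_header (portOp_append _) _).trans (atName_header portOp_tail q)
  · exact Port.SameHeader.refl q

theorem queueEffect_of_ne {q : Port Msg} (hs : q.name ≠ sn) (hd : q.name ≠ dn) :
    queueEffect sc rule sn dn src dst q = q := by
  unfold queueEffect
  split
  · split
    · split_ifs
      · exact atName_of_ne hs
      · rfl
    · split_ifs
      · rfl
      · exact atName_of_ne hs
      · rw [atName_of_ne hs, atName_of_ne hd]
  · rfl

/-- Under `blind` the ports other than the destination do not depend on the destination. -/
theorem queueEffect_blind_of_ne {q : Port Msg} (hd : q.name ≠ dn) (dst' : Option (Port Msg)) :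
    queueEffect sc .blind sn dn src dst q = queueEffect sc .blind sn dn src dst' q := by
  have key : ∀ m : Msg, atName dn (Port.append m) (atName sn Port.tail q) =
      atName sn Port.tail q := fun m =>
    atName_of_ne (by rwa [(atName_header portOp_tail q).name])
  unfold queueEffect
  split
  · cases dst <;> cases dst' <;> simp [key]
  · rfl

/-- The new length of the destination buffer depends on its old length only. -/
theorem queueEffect_length (hne : dn ≠ sn) {q q' : Port Msg} (hq : q.name = dn)
    (hqq : q.SameHeader q') (hl : q.msgs.length = q'.msgs.length) :
    (queueEffect sc rule sn dn src (some q) q).msgs.length =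
      (queueEffect sc rule sn dn src (some q') q').msgs.length := by
  have hq' : q'.name = dn := hqq.name.symm.trans hq
  have hiff : q.IsFull sc ↔ q'.IsFull sc :=
    ⟨fun hf => hf.congr hqq hl, fun hf => hf.congr hqq.symm hl.symm⟩
  have ht : atName sn Port.tail q = q := atName_of_ne (hq ▸ hne)
  have ht' : atName sn Port.tail q' = q' := atName_of_ne (hq' ▸ hne)
  unfold queueEffect
  split
  · by_cases hf : q.IsFull sc
    · simp only [if_pos hf, if_pos (hiff.1 hf), ht, ht']
      split_ifs <;> exact hl
    · simp only [if_neg hf, if_neg (mt hiff.2 hf), ht, ht']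
      rw [atName, atName, if_pos hq, if_pos hq']
      exact (portOp_append _).length q q' hqq hl
  · exact hl

end queueEffect

theorem transfQueMsgLost_eq (rule : LossRule) {s : KState sc Msg} (hs : s.Conforms)
    (i : ChannelId) {sn dn : PortName} (hne : dn ≠ sn) :
    transfQueMsgLost rule s (.queuing i sn dn) = s.mapPorts fun _ =>
      queueEffect sc rule sn dn (s.portByName sn) (s.portByName dn) := by
  simp only [transfQueMsgLost, KState.portByName]
  cases hsp : s.portIdByName sn with
  | none => exact s.mapPorts_id.symm
  | some sp =>
    obtain ⟨q, hq, rfl⟩ := KState.exists_of_portIdByName hsp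
    have hrem := KState.removeMsg_fst hq
    rw [← hs.mapPorts_atName hq] at hrem
    dsimp only
    rw [Option.bind_some, hq, hrem]
    rcases q with ⟨n, d, _ | ⟨m, b⟩⟩ | ⟨n, d, b⟩
    · have hm : (s.removeMsg sp).2 = none := by simp [KState.removeMsg, hq]
      rw [hm]
      exact s.mapPorts_id.symm
    · have hm : (s.removeMsg sp).2 = some m := by simp [KState.removeMsg, hq]
      rw [hm]
      dsimp only
      cases hdp : s.portIdByName dn with
      | none =>
        delta queueEffect
        dsimp only [Option.bind_none]
        split_ifs
        · rfl
        · exact s.mapPorts_id.symm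
      | some dp =>
        obtain ⟨r, hr, rfl⟩ := KState.exists_of_portIdByName hdp
        -- The removal at the source leaves the destination port as it was.
        have hr' : (s.mapPorts fun _ => atName (Port.queuing n d (m :: b)).name Port.tail).comm dp
            = some r := by
          simp [KState.mapPorts, hr, atName_of_ne hne]
        rw [Option.bind_some, hr]
        delta queueEffect
        dsimp only
        by_cases hf : r.IsFull sc
        · rw [if_pos ((KState.isFullQueuing_iff hr').2 hf)]
          simp only [if_pos hf]
          split_ifs
          · exact s.mapPorts_id.symm
          · rfl
        · rw [if_neg (mt (KState.isFullQueuing_iff hr').1 hf)]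
          simp only [if_neg hf]
          rw [KState.insertMsg_eq hr', ← (hs.mapPorts fun _ =>
            atName_header portOp_tail).mapPorts_atName hr']
          simp [KState.mapPorts, Function.comp_def]
    · have hm : (s.removeMsg sp).2 = none := by simp [KState.removeMsg, hq]
      rw [hm]
      exact s.mapPorts_id.symm

theorem secureTransmission_transfQueMsgLost (hsc : sc.Valid) (rule : LossRule) {ch : Channel}
    (hch : ch ∈ sc.channels) :
    SecureTransmission rule fun s : KState sc Msg => transfQueMsgLost rule s ch := by
  cases ch with
  | sampling => exact secureTransmission_id rule
  | queuing i sn dn =>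
    obtain ⟨c, hc, hcd⟩ := hsc.dir_of_isSrc hch (n := sn) rfl
    obtain ⟨c', hc', hcd'⟩ := hsc.dir_of_isDst hch (n := dn) rfl
    have hne : dn ≠ sn := by
      rintro rfl
      cases hc.symm.trans hc'
      cases hcd.symm.trans hcd'
    have hsrc : ∀ {s t : KState sc Msg}, s.Conforms → t.Conforms → VpeqTrm rule s t →
        s.portByName sn = t.portByName sn :=
      fun hs ht h => hs.portByName_congr ht h fun _ => ⟨c, hc, hcd⟩
    have hdst : ∀ {s t : KState sc Msg}, s.Conforms → t.Conforms → VpeqTrm rule s t →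
        rule ≠ .blind → s.portByName dn = t.portByName dn :=
      fun hs ht h hb => hs.portByName_congr ht h fun hb' => absurd hb' hb
    refine secureTransmission_of_mapPorts hsc
      (fun s hs => transfQueMsgLost_eq rule hs i hne) (fun s q => queueEffect_header q)
      (fun s t p q hs ht h hq hd => ?_) (fun s t p q q' hs ht h hq hq' hd hqq hl => ?_)
    · rw [hsrc hs ht h]
      by_cases hb : rule = .blind
      · subst hb
        refine queueEffect_blind_of_ne ?_ _
        rintro rfl
        cases (hd rfl).symm.trans ((hs.dir_eq hq hc').trans hcd')
      · rw [hdst hs ht h hb]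
    · have hns : q.name ≠ sn := by
        rintro rfl
        cases hd.symm.trans ((hs.dir_eq hq hc).trans hcd)
      by_cases hnd : q.name = dn
      · rw [hsrc hs ht h, hs.portByName_eq_some_iff.2 ⟨p, hq, hnd⟩,
          ht.portByName_eq_some_iff.2 ⟨p, hq', hqq.name.symm.trans hnd⟩]
        exact queueEffect_length hne hnd hqq hl
      · rw [queueEffect_of_ne hns hnd, queueEffect_of_ne (hqq.name ▸ hns) (hqq.name ▸ hnd), hl]

/-! ### The top-level specification -/

section topLevel

variable (sel : Selection sc) (rule : LossRule)

theorem mem_execEvent {s s' : KState sc Msg} {e : Event Msg} :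
    (s, s') ∈ execEvent sel rule e ↔
      EventEnabled s e ∧ s' ∈ eventSpec sel rule e s ∨ ¬ EventEnabled s e ∧ s' = s := by
  by_cases h : EventEnabled s e <;> simp [execEvent, h]

/-- The invariant makes the security properties of services and transmissions available in all
reachable states. -/
theorem conforms_of_reachable (hsc : sc.Valid) {s : KState sc Msg}
    (hs : SecModel.Reachable (topLevel sc Msg sel rule) s) : s.Conforms := by
  refine SecModel.Reachable.induction (M := topLevel sc Msg sel rule)
    (fun p => Or.inl ⟨rfl, rfl⟩) (fun s s' e hs h => ?_) hs
  obtain ⟨hen, h⟩ | ⟨-, rfl⟩ := (mem_execEvent sel rule).1 h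
  · rcases e with h' | _ | ch | ch
    · cases h
      cases hc : s.cur with
      | part a => exact (secureService_execHypercall hsc rule a h').conforms s hs hc
      | sched => simp [EventEnabled, hc, Dom.IsPart] at hen
      | trans => simp [EventEnabled, hc, Dom.IsPart] at hen
    · cases h; exact hs
    · cases h; exact (secureTransmission_transfSamplingMsg hsc rule hen.2).conforms s hs
    · cases h; exact (secureTransmission_transfQueMsgLost hsc rule hen.2).conforms s hs
  · exact hs

theorem topLevel_isSecurityModel :
    SecModel.IsSecurityModel (topLevel sc Msg sel rule) where
  sched_ne_trans := by rintro ⟨⟩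
  part_intf p₁ p₂ h₁ h₁' h₂ h₂' hne h := by
    cases p₁ with
    | sched => exact absurd rfl h₁
    | trans => exact absurd rfl h₁'
    | part a =>
      cases p₂ with
      | sched => exact absurd rfl h₂
      | trans => exact absurd rfl h₂'
      | part b => exact absurd (congrArg Dom.part h) hne
  sched_intf _ := trivial
  intf_sched d h := by
    cases d with
    | sched => rfl
    | part a => exact h.elim
    | trans => exact h.elim
  equivalence := vpeq_equivalence rule
  kdom_eq s t e h := by
    rcases e with h' | _ | ch | ch
    · exact h
    all_goals rfl
  enabled s e _ := by
    classical
    suffices h : (if EventEnabled s e then eventSpec sel rule e s else {s}).Nonempty from h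
    split_ifs
    · rcases e with h' | _ | ch | ch <;> exact ⟨_, rfl⟩
    · exact ⟨s, rfl⟩

theorem intf_of_channelFromTo {a b : sc.Part} (h : sc.ChannelFromTo a b) :
    Interference sc rule (.part a) .trans ∧ Interference sc rule .trans (.part b) := by
  obtain ⟨ch, hch, ⟨n, hn, hs⟩, ⟨n', hn', hd⟩⟩ := h
  exact ⟨⟨n, hn, ch, hch, Or.inl hs⟩, ⟨n', hn', ch, hch, hd⟩⟩

theorem topLevel_locallyRespects (hsc : sc.Valid) (e : Event Msg) :
    SecModel.LocallyRespects (topLevel sc Msg sel rule) e := by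
  intro d s s' hr hn h
  have hs := conforms_of_reachable sel rule hsc hr
  change ¬ Interference sc rule (eventDom s e) d at hn
  change Vpeq rule d s s'
  have htrm : ∀ F : KState sc Msg → KState sc Msg, SecureTransmission rule F →
      ¬ Interference sc rule .trans d → Vpeq rule d s (F s) := by
    intro F hF hn
    cases d with
    | part b => exact hF.part s b hs hn
    | sched => exact (hF.cur s hs).symm
    | trans => exact absurd trivial hn
  obtain ⟨hen, h⟩ | ⟨-, rfl⟩ := (mem_execEvent sel rule).1 h
  · rcases e with h' | _ | ch | ch
    · cases h
      cases hc : s.cur with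
      | part a =>
        have hF := secureService_execHypercall hsc rule a h'
        simp only [eventDom, hc] at hn
        cases d with
        | part b => exact hF.part s b hs hc fun hab => hn (Subtype.ext hab)
        | sched => exact (hF.cur s hc).symm
        | trans => exact hF.trm s hs hc hn
      | sched => simp [EventEnabled, hc, Dom.IsPart] at hen
      | trans => simp [EventEnabled, hc, Dom.IsPart] at hen
    · exact absurd trivial hn
    · cases h
      exact htrm _ (secureTransmission_transfSamplingMsg hsc rule hen.2) hn
    · cases h
      exact htrm _ (secureTransmission_transfQueMsgLost hsc rule hen.2) hn
  · exact (vpeq_equivalence rule d).refl _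

/-- Enabledness depends on the current domain only. -/
theorem eventEnabled_congr {s t : KState sc Msg} (h : s.cur = t.cur) (e : Event Msg) :
    EventEnabled s e ↔ EventEnabled t e := by
  rcases e with h' | _ | ch | ch <;> simp only [EventEnabled, h]

theorem topLevel_stepConsistent (hsc : sc.Valid) (e : Event Msg) :
    SecModel.StepConsistent (topLevel sc Msg sel rule) e := by
  intro d s t hrs hrt hd hst hi hk s' t' h h'
  have hs := conforms_of_reachable sel rule hsc hrs
  have ht := conforms_of_reachable sel rule hsc hrt
  change s.cur = t.cur at hst
  change Interference sc rule (eventDom s e) d at hi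
  change Vpeq rule (eventDom s e) s t at hk
  change Vpeq rule d s t at hd
  change Vpeq rule d s' t'
  replace h := (mem_execEvent sel rule).1 h
  replace h' := (mem_execEvent sel rule).1 h'
  rw [← eventEnabled_congr hst e] at h'
  have htrm : ∀ F : KState sc Msg → KState sc Msg, SecureTransmission rule F →
      VpeqTrm rule s t → Vpeq rule d (F s) (F t) := by
    intro F hF hk
    cases d with
    | part b => exact hF.part_congr s t b hs ht hk hd
    | sched => exact (hF.cur s hs).trans (hst.trans (hF.cur t ht).symm)
    | trans => exact hF.trm_congr s t hs ht hk
  obtain ⟨hen, h⟩ | ⟨hen, rfl⟩ := h <;> obtain ⟨hen', h'⟩ | ⟨hen', rfl⟩ := h'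
  · rcases e with c | _ | ch | ch
    · cases h
      cases h'
      cases hc : s.cur with
      | part a =>
        have hF := secureService_execHypercall hsc rule a c
        have hc' := hst.symm.trans hc
        simp only [eventDom, hc] at hi hk
        cases d with
        | part b =>
          cases hi
          exact hF.part_congr s t hs ht hc hc' hk
        | sched => exact (hF.cur s hc).trans (hst.trans (hF.cur t hc').symm)
        | trans => exact hF.trm_congr s t hs ht hc hc' hk hd
      | sched => simp [EventEnabled, hc, Dom.IsPart] at hen
      | trans => simp [EventEnabled, hc, Dom.IsPart] at hen
    · cases h
      cases h'
      cases d with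
      | part b => exact hd
      | sched => exact congrArg sel.next hst
      | trans => exact hd
    · cases h
      cases h'
      exact htrm _ (secureTransmission_transfSamplingMsg hsc rule hen.2) hk
    · cases h
      cases h'
      exact htrm _ (secureTransmission_transfQueMsgLost hsc rule hen.2) hk
  · exact absurd hen hen'
  · exact absurd hen' hen
  · exact hd

end topLevel

end Arinc

theorem mainTheorem6 (sc : Arinc.SysConfig) (hsc : sc.Valid) (Msg : Type u)
    (sel : Arinc.Selection sc) (rule : Arinc.LossRule) :
    SecModel.IsSecurityModel (Arinc.topLevel sc Msg sel rule) ∧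
    (∀ a b : sc.Part, sc.ChannelFromTo a b →
      (Arinc.topLevel sc Msg sel rule).intf (.part a) .trans ∧
        (Arinc.topLevel sc Msg sel rule).intf .trans (.part b)) ∧
    (∀ e, SecModel.StepConsistent (Arinc.topLevel sc Msg sel rule) e) ∧
    (∀ e, SecModel.LocallyRespects (Arinc.topLevel sc Msg sel rule) e) ∧
    SecModel.Noninfluence (Arinc.topLevel sc Msg sel rule) ∧
    SecModel.WeakNoninfluence (Arinc.topLevel sc Msg sel rule) ∧
    SecModel.Nonleakage (Arinc.topLevel sc Msg sel rule) ∧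
    SecModel.NoninterferenceR (Arinc.topLevel sc Msg sel rule) ∧
    SecModel.WeakNoninterferenceR (Arinc.topLevel sc Msg sel rule) ∧
    SecModel.Noninterference (Arinc.topLevel sc Msg sel rule) ∧
    SecModel.WeakNoninterference (Arinc.topLevel sc Msg sel rule) := by
  have hM := Arinc.topLevel_isSecurityModel (Msg := Msg) sel rule
  have hsc' := Arinc.topLevel_stepConsistent (Msg := Msg) sel rule hsc
  have hlr := Arinc.topLevel_locallyRespects (Msg := Msg) sel rule hsc
  have hni := SecModel.noninfluence hM hsc' hlr
  have hwni := SecModel.weakNoninfluence hM hsc' hlr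
  have hr := SecModel.NoninterferenceR.of_noninfluence hM hni
  have hwr := SecModel.WeakNoninterferenceR.of_weakNoninfluence hM hwni
  exact ⟨hM, fun a b => Arinc.intf_of_channelFromTo rule, hsc', hlr, hni, hwni,
    SecModel.nonleakage hM hsc' hlr, hr, hwr, fun d es => hr d es _ SecModel.reachable_s0,
    fun d es₁ es₂ => hwr d es₁ es₂ _ SecModel.reachable_s0⟩
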